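/- Let $F_2$ be the free group on $x_1, x_2$. A cyclic word in $F_2$ is a cyclically ordered sequence of letters from $\{x_1^{\pm1},x_2^{\pm1}\}$ in which no two cyclically adjacent letters are mutually inverse; $|u|$ denotes its length, i.e. its number of letters. For $\phi \in \mathrm{Aut}(F_2)$, $\phi(u)$ is the cyclic word obtained by applying $\phi$ to $u$ and then reducing cyclically; $\mathrm{Orb}(u)=\{\phi(u) : \phi\in \mathrm{Aut}(F_2)\}$, and $N(u)$ is the cardinality of $\{v \in \mathrm{Orb}(u) : |v| = |u|\}$. Say that $u$ satisfies hypothesis (H) if (i) $|u| \le |v|$ for all $v \in \mathrm{Orb}(u)$, and (ii) if $x_1^{\pm1}$ and $x_2^{\pm1}$ both occur in $u$, then the total number of occurrences of $x_1^{\pm1}$ in $u$ is strictly less than the total number of occurrences of $x_2^{\pm1}$ in $u$. Theorem. (a) If $u$ is a cyclic word in $F_2$ that satisfies (H) and $|u| \ge 9$, then $N(u) \le 8|u| - 40$. (b) For every integer $\ell \ge 3$, the cyclic word $u = x_1^2 x_2 x_1^{-1} x_2 x_1 x_2^{\ell}$ satisfies (H), has length $|u| = \ell + 6$, and $N(u)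 = 8|u| - 40$. (c) In particular, there is a sequence $(u_l)$ of cyclic words in $F_2$ satisfying (H) such that $|u_l| \ge 9$, $|u_l| \to \infty$ as $l \to \infty$, and $N(u_l) = 8|u_l| - 40$ for all $l$. Thus $8|u| - 40$ is the sharp bound for $N(u)$ when $|u| \ge 9$. -/

import Mathlib

/-- The letters of `F_n`: `(i, true)` is the generator with index `i`, and `(i, false)` is its
inverse (the convention of `FreeGroup`).  The indices run through `Fin n = {0, …, n - 1}`. -/
abbrev Letter (n : ℕ) : Type := Fin n × Bool

/-- A cyclic word in `F_n`: a cyclically ordered sequence of letters (a list of letters up to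
rotation) in which no two cyclically adjacent letters are inverse to each other. -/
def CyclicWord (n : ℕ) : Type :=
  {c : Cycle (Letter n) // c.Chain fun a b => a.1 = b.1 → a.2 = b.2}

namespace CyclicWord

variable {n : ℕ}

/-- The length `|w|` of a cyclic word. -/
def length (w : CyclicWord n) : ℕ := w.1.length

/-- The total number of occurrences of the generator with index `i` and of its inverse. -/
def occ (w : CyclicWord n) (i : Fin n) : ℕ := w.1.toMultiset.countP fun a => a.1 = i

theorem chain_coe_iff (L : List (Letter n)) :
    ((L : Cycle (Letter n)).Chain fun a b => a.1 = b.1 → a.2 = b.2) ↔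
      FreeGroup.IsCyclicallyReduced L := by
  rcases eq_or_ne L [] with rfl | hL
  · simp
  · rw [Cycle.chain_ne_nil _ hL, List.isChain_cons, FreeGroup.isCyclicallyReduced_iff,
      FreeGroup.IsReduced, and_comm, List.getLast?_eq_some_getLast hL]
    simp

/-- The cyclic word of an element of `F_n`: write the element as a reduced word, delete pairs of
mutually inverse first and last letters as long as possible, and read the result cyclically. -/
def ofElement (g : FreeGroup (Fin n)) : CyclicWord n :=
  ⟨(FreeGroup.reduceCyclically g.toWord : Cycle (Letter n)), (chain_coe_iff _).2
    (FreeGroup.reduceCyclically.isCyclicallyReduced FreeGroup.isReduced_toWord)⟩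

theorem reduceCyclically_eq_self {L : List (Letter n)} (h : FreeGroup.IsCyclicallyReduced L) :
    FreeGroup.reduceCyclically L = L := by
  induction L using List.bidirectionalRec with
  | nil => simp
  | singleton a => simp
  | cons_append a l b _ =>
    rw [FreeGroup.reduceCyclically.cons_append, if_neg]
    · simp
    · rintro ⟨h1, h2⟩
      have h3 := (FreeGroup.isCyclicallyReduced_cons_append_iff.1 (by simpa using h)).2 h1
      rw [h3] at h2
      simp at h2

theorem ofElement_mk_val {L : List (Letter n)} (h : FreeGroup.IsReduced L) :
    (ofElement (FreeGroup.mk L)).1 = (FreeGroup.reduceCyclically L : Cycle (Letter n)) := by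
  simp [ofElement, FreeGroup.toWord_mk, h.reduce_eq]

/-- Rotating one letter of a cyclically reduced word does not change the cyclic word. -/
theorem ofElement_mk_cons {a : Letter n} {L : List (Letter n)}
    (h : FreeGroup.IsCyclicallyReduced (a :: L)) :
    ofElement (FreeGroup.mk (L ++ [a])) = ofElement (FreeGroup.mk (a :: L)) := by
  have h' : FreeGroup.IsCyclicallyReduced (L ++ [a]) := by
    rw [← chain_coe_iff] at h ⊢
    rwa [← Cycle.coe_cons_eq_coe_append]
  apply Subtype.ext
  rw [ofElement_mk_val h.isReduced, ofElement_mk_val h'.isReduced, reduceCyclically_eq_self h,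
    reduceCyclically_eq_self h', Cycle.coe_cons_eq_coe_append]

/-- Conjugating by a letter does not change the cyclic word. -/
theorem ofElement_conj_letter (a : Letter n) (g : FreeGroup (Fin n)) :
    ofElement (FreeGroup.mk [a] * g * (FreeGroup.mk [a])⁻¹) = ofElement g := by
  obtain ⟨i, e⟩ := a
  obtain ⟨L, hL, rfl⟩ : ∃ L, FreeGroup.IsReduced L ∧ g = FreeGroup.mk L :=
    ⟨g.toWord, FreeGroup.isReduced_toWord, FreeGroup.mk_toWord.symm⟩
  have hinv : (FreeGroup.mk [(i, e)])⁻¹ = FreeGroup.mk [(i, !e)] := by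
    simp [FreeGroup.inv_mk, FreeGroup.invRev]
  rcases eq_or_ne L [] with rfl | hne
  · rw [← FreeGroup.one_eq_mk, mul_one, mul_inv_cancel]
  by_cases hs : L.head? = some (i, !e)
  · obtain ⟨M, rfl⟩ := List.head?_eq_some_iff.1 hs
    rcases M.eq_nil_or_concat with rfl | ⟨M, b, rfl⟩
    · rw [← hinv]; congr 1; group
    rw [List.concat_eq_append] at *
    by_cases hb : b = (i, e)
    · subst hb
      have hM : FreeGroup.IsReduced M := hL.infix ⟨[(i, !e)], [(i, e)], by simp⟩
      have h1 : FreeGroup.mk ((i, !e) :: (M ++ [(i, e)])) =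
          (FreeGroup.mk [(i, e)])⁻¹ * FreeGroup.mk M * FreeGroup.mk [(i, e)] := by
        rw [hinv]; simp
      have h2 : FreeGroup.mk [(i, e)] * FreeGroup.mk ((i, !e) :: (M ++ [(i, e)])) *
          (FreeGroup.mk [(i, e)])⁻¹ = FreeGroup.mk M := by rw [h1]; group
      rw [h2]
      apply Subtype.ext
      rw [ofElement_mk_val hM, ofElement_mk_val hL, FreeGroup.reduceCyclically.cons_append]
      simp
    · have hc : FreeGroup.IsCyclicallyReduced ((i, !e) :: (M ++ [b])) := by
        have := (FreeGroup.isCyclicallyReduced_cons_append_iff (L := M) (a := b) (b := (i, !e))).2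
        refine this ⟨hL, fun h3 => ?_⟩
        obtain ⟨j, f⟩ := b
        have h3' : j = i := h3
        subst h3'
        cases e <;> cases f <;> simp_all
      rw [← ofElement_mk_cons hc]
      congr 1
      have h1 : FreeGroup.mk ((i, !e) :: (M ++ [b])) =
          (FreeGroup.mk [(i, e)])⁻¹ * FreeGroup.mk (M ++ [b]) := by rw [hinv]; simp
      have h2 : FreeGroup.mk (M ++ [b] ++ [(i, !e)]) =
          FreeGroup.mk (M ++ [b]) * (FreeGroup.mk [(i, e)])⁻¹ := by rw [hinv]; simp
      rw [h1, h2]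
      group
  · rcases L.eq_nil_or_concat with rfl | ⟨M, b, rfl⟩
    · exact absurd rfl hne
    rw [List.concat_eq_append] at *
    by_cases hb : b = (i, e)
    · subst hb
      have hc' : FreeGroup.IsCyclicallyReduced (M ++ [(i, e)]) := by
        rw [FreeGroup.isCyclicallyReduced_iff]
        refine ⟨hL, fun c hc d hd h3 => ?_⟩
        rw [List.getLast?_concat, Option.mem_some_iff] at hc
        subst hc
        obtain ⟨j, f⟩ := d
        have h3' : i = j := h3
        subst h3'
        rw [Option.mem_def] at hd
        rw [hd] at hs
        cases e <;> cases f <;> simp_all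
      have hc : FreeGroup.IsCyclicallyReduced ((i, e) :: M) := by
        rw [← chain_coe_iff] at hc' ⊢
        rwa [Cycle.coe_cons_eq_coe_append]
      rw [ofElement_mk_cons hc]
      congr 1
      have h1 : FreeGroup.mk (M ++ [(i, e)]) = FreeGroup.mk M * FreeGroup.mk [(i, e)] := by simp
      have h2 : FreeGroup.mk ((i, e) :: M) = FreeGroup.mk [(i, e)] * FreeGroup.mk M := by simp
      rw [h1, h2]
      group
    · have hr : FreeGroup.IsReduced ((i, e) :: ((M ++ [b]) ++ [(i, !e)])) := by
        rw [FreeGroup.IsReduced, List.isChain_cons, List.isChain_append]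
        refine ⟨fun d hd h3 => ?_, hL, List.isChain_singleton _, fun c hc d hd h3 => ?_⟩
        · rw [List.head?_append_of_ne_nil _ hne, Option.mem_def] at hd
          obtain ⟨j, f⟩ := d
          have h3' : i = j := h3
          subst h3'
          rw [hd] at hs
          cases e <;> cases f <;> simp_all
        · rw [List.getLast?_concat, Option.mem_some_iff] at hc
          subst hc
          simp only [List.head?_cons, Option.mem_some_iff] at hd
          subst hd
          obtain ⟨j, f⟩ := b
          have h3' : j = i := h3
          subst h3'
          cases e <;> cases f <;> simp_all
      have h1 : FreeGroup.mk [(i, e)] * FreeGroup.mk (M ++ [b]) * (FreeGroup.mk [(i, e)])⁻¹ =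
          FreeGroup.mk ((i, e) :: ((M ++ [b]) ++ [(i, !e)])) := by
        rw [hinv]; simp
      rw [h1]
      apply Subtype.ext
      rw [ofElement_mk_val hr, ofElement_mk_val hL, FreeGroup.reduceCyclically.cons_append]
      simp

theorem ofElement_conj (h g : FreeGroup (Fin n)) : ofElement (h * g * h⁻¹) = ofElement g := by
  rw [← FreeGroup.mk_toWord (x := h)]
  induction h.toWord with
  | nil => simp [← FreeGroup.one_eq_mk]
  | cons a L ih =>
    have : FreeGroup.mk (a :: L) = FreeGroup.mk [a] * FreeGroup.mk L := by simp
    rw [this, ← ih, ← ofElement_conj_letter a (FreeGroup.mk L * g * (FreeGroup.mk L)⁻¹)]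
    congr 1
    group

theorem ofElement_eq_of_isConj {g h : FreeGroup (Fin n)} (hgh : IsConj g h) :
    ofElement g = ofElement h := by
  obtain ⟨c, rfl⟩ := isConj_iff.1 hgh
  rw [ofElement_conj]

theorem isConj_mk_of_isRotated {L L' : List (Letter n)} (h : L ~r L') :
    IsConj (FreeGroup.mk L) (FreeGroup.mk L') := by
  obtain ⟨k, hk⟩ := h.symm
  obtain ⟨A, B, rfl, rfl⟩ : ∃ A B, L' = A ++ B ∧ L = B ++ A := by
    refine ⟨L'.take (k % L'.length), L'.drop (k % L'.length), by simp, ?_⟩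
    rw [← hk, List.rotate_eq_drop_append_take_mod]
  rw [isConj_iff]
  refine ⟨FreeGroup.mk A, ?_⟩
  rw [← FreeGroup.mul_mk, ← FreeGroup.mul_mk]
  group

/-- The action of an automorphism `φ` of `F_n` on cyclic words: apply `φ` to the element of `F_n`
obtained by reading `w` from any starting point, and take the cyclic word of the result. -/
def map (φ : MulAut (FreeGroup (Fin n))) (w : CyclicWord n) : CyclicWord n :=
  Quotient.lift (s := List.IsRotated.setoid (Letter n))
    (fun L : List (Letter n) => ofElement (φ (FreeGroup.mk L)))
    (fun _ _ h => ofElement_eq_of_isConj (φ.toMonoidHom.map_isConj (isConj_mk_of_isRotated h))) w.1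

/-- The automorphic orbit `Orb_{Aut F_n}(w)`. -/
def orbit (w : CyclicWord n) : Set (CyclicWord n) :=
  {v | ∃ φ : MulAut (FreeGroup (Fin n)), v = map φ w}

/-- `N(u)`: the number of cyclic words in the automorphic orbit of `u` of the same length as `u`.
The set is finite, see `finite_length_eq`. -/
noncomputable def N (u : CyclicWord n) : ℕ :=
  Set.ncard {v : CyclicWord n | v ∈ orbit u ∧ v.length = u.length}

theorem finite_length_eq (k : ℕ) : {v : CyclicWord n | v.length = k}.Finite := by
  refine Set.Finite.of_finite_image (f := Subtype.val) ?_ Subtype.val_injective.injOn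
  refine ((List.finite_length_eq (Letter n) k).image
    (fun L : List (Letter n) => (L : Cycle (Letter n)))).subset ?_
  rintro _ ⟨⟨c, hc⟩, hv, rfl⟩
  induction c using Quotient.inductionOn with
  | h L => exact ⟨L, hv, rfl⟩

/-- The hypothesis on a cyclic word `u` in `F_n`: (i) `u` has minimum length in its automorphic
orbit, and (ii) if the generators with indices `i < j` both occur in `u` (possibly inverted), then
the former occurs strictly fewer times than the latter. -/
def Hyp (u : CyclicWord n) : Prop :=
  (∀ v ∈ orbit u, u.length ≤ v.length) ∧
    ∀ i j : Fin n, i < j → 0 < u.occ i → 0 < u.occ j → u.occ i < u.occ j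

/-- The cyclic word `x₁² x₂ x₁⁻¹ x₂ x₁ x₂^ℓ` in `F₂`. -/
def extremal (ℓ : ℕ) : CyclicWord 2 :=
  let x₁ : FreeGroup (Fin 2) := FreeGroup.of 0
  let x₂ : FreeGroup (Fin 2) := FreeGroup.of 1
  ofElement (x₁ ^ 2 * x₂ * x₁⁻¹ * x₂ * x₁ * x₂ ^ ℓ)

end CyclicWord

/-!
The group `Aut F₂` acts on cyclic words through `Out F₂` (`CyclicWord.act`).  Write `p` and `q` for
the numbers of letters `x₁^{±1}` and `x₂^{±1}` of a cyclic word, `τᵗ` for the transvection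
`x₁ ↦ x₁ x₂ᵗ` (`CyclicWord.transvection`), and call the eight automorphisms that permute the letters
signed permutations.

*Peak reduction.*  If `u` has minimal length in its orbit and `p u < q u`, then the words of the
same length in the orbit of `u` are of the form `σ (τᵗ u)` with a signed permutation `σ`
(`CyclicWord.length_le_act`).  By Nielsen's theorem (`CyclicWord.nielsen_eq_top`) and the relations
in `Out F₂`, every automorphism acts as `σ w η`, where `w` is a positive word in `x₁ ↦ x₁ x₂` and
`x₂ ↦ x₂ x₁`, and `η` is the identity or the sign change of `x₂`
(`exists_signed_mul_positive_of_mem_closure`).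
Along a positive word the length is convex: if `a` and `b` denote the two transvections, then
`q (a v) = p (b v)` (the bases `{x₁, x₂}`, `{x₁x₂, x₂}`, `{x₁, x₁x₂}` form a triangle of the Farey
graph), `p (a v) = p v`, and `q (a (a v)) + q v ≥ 2 q (a v)`.  So if the length does not decrease
in the first step, it never does; a step by `a` may preserve it, while a step by `b` strictly
increases it because `p u < q u`.

*Counting.*  If all `τᵗ` fix `u`, then `N u ≤ 8`; this includes the case `p u = 0`.  If `p u > 0`,
write `u` as a cyclic sequence of syllables `x₁^ε x₂ᵏ`.  The
transvection `τᵗ` replaces `k` by `k ± t` if the next syllable has the same sign `ε`, and fixes `k`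
otherwise (`CyclicWord.act_transvection_flat`).  Let `n` be the number of moving and `z` the number
of fixed syllables, so that `p u = n + z`; then `z` is even, and a fixed syllable has `k ≠ 0`.  If
`T` is the distance of the extreme exponents `t` for which `τᵗ u` has the length of `u`, then
`n T + 2 z ≤ 2 q u` (`CyclicWord.moving_mul_add_le`), and `n` is even if `T > 0`.  For `n ≥ 4`, and
for `n = 2`, `z ≥ 2`, this gives `T + 1 ≤ |u| - 5`, hence `N u ≤ 8 (|u| - 5)`.  For `n = 2`, `z = 0`
one only has `T + 1 ≤ |u| - 1`, but then the sign change of `x₂` reflects the sequence of the words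
`τᵗ u`, so that `N u ≤ 4 (|u| - 1)`, which suffices because `|u| ≥ 9`.

*Sharpness.*  For `u = x₁² x₂ x₁⁻¹ x₂ x₁ x₂^ℓ` one has `n = z = 2` and `T = ℓ`, and the words
`σ (τ⁻ˢ u)`, `0 ≤ s ≤ ℓ`, are pairwise distinct (`CyclicWord.signedPerm_extremal_injective`).
-/

/-! ### The action of automorphisms on cyclic words -/

namespace CyclicWord

section action

variable {n : ℕ}

theorem exists_isCyclicallyReduced (w : CyclicWord n) :
    ∃ L : List (Letter n), FreeGroup.IsCyclicallyReduced L ∧ w.1 = (L : Cycle (Letter n)) := by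
  obtain ⟨c, hc⟩ := w
  induction c using Quotient.inductionOn with
  | h L => exact ⟨L, (chain_coe_iff L).1 hc, rfl⟩

theorem ofElement_mk_val_of_isCyclicallyReduced {L : List (Letter n)}
    (h : FreeGroup.IsCyclicallyReduced L) :
    (ofElement (FreeGroup.mk L)).1 = (L : Cycle (Letter n)) := by
  rw [ofElement_mk_val h.isReduced, reduceCyclically_eq_self h]

theorem exists_eq_ofElement_mk (w : CyclicWord n) :
    ∃ L : List (Letter n), FreeGroup.IsCyclicallyReduced L ∧ w = ofElement (FreeGroup.mk L) := by
  obtain ⟨L, hL, h⟩ := exists_isCyclicallyReduced w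
  exact ⟨L, hL, Subtype.ext (h.trans (ofElement_mk_val_of_isCyclicallyReduced hL).symm)⟩

theorem map_eq_of_val_eq (φ : MulAut (FreeGroup (Fin n))) {w : CyclicWord n}
    {L : List (Letter n)} (h : w.1 = (L : Cycle (Letter n))) :
    map φ w = ofElement (φ (FreeGroup.mk L)) := by
  obtain ⟨c, hc⟩ := w
  subst h
  rfl

theorem isConj_mk_reduceCyclically (g : FreeGroup (Fin n)) :
    IsConj (FreeGroup.mk (FreeGroup.reduceCyclically g.toWord)) g := by
  rw [isConj_iff]
  refine ⟨FreeGroup.mk (FreeGroup.reduceCyclically.conjugator g.toWord), ?_⟩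
  rw [FreeGroup.inv_mk, FreeGroup.mul_mk, FreeGroup.mul_mk,
    FreeGroup.reduceCyclically.conj_conjugator_reduceCyclically, FreeGroup.mk_toWord]

theorem map_ofElement (φ : MulAut (FreeGroup (Fin n))) (g : FreeGroup (Fin n)) :
    map φ (ofElement g) = ofElement (φ g) := by
  rw [map_eq_of_val_eq φ (L := FreeGroup.reduceCyclically g.toWord) rfl]
  exact ofElement_eq_of_isConj (φ.toMonoidHom.map_isConj (isConj_mk_reduceCyclically g))

theorem map_one (w : CyclicWord n) : map 1 w = w := by
  obtain ⟨L, -, rfl⟩ := exists_eq_ofElement_mk w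
  rw [map_ofElement, MulAut.one_apply]

theorem map_mul (φ ψ : MulAut (FreeGroup (Fin n))) (w : CyclicWord n) :
    map (φ * ψ) w = map φ (map ψ w) := by
  obtain ⟨L, -, rfl⟩ := exists_eq_ofElement_mk w
  simp only [map_ofElement, MulAut.mul_apply]

/-- The action of `Aut F_n` on cyclic words, as a homomorphism to the permutation group.  It
factors through `Out F_n`, see `act_conj`. -/
def act : MulAut (FreeGroup (Fin n)) →* Equiv.Perm (CyclicWord n) where
  toFun φ :=
    { toFun := map φ
      invFun := map φ⁻¹
      left_inv := fun w => by rw [← map_mul, inv_mul_cancel, map_one]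
      right_inv := fun w => by rw [← map_mul, mul_inv_cancel, map_one] }
  map_one' := Equiv.ext map_one
  map_mul' φ ψ := Equiv.ext (map_mul φ ψ)

theorem act_ofElement (φ : MulAut (FreeGroup (Fin n))) (g : FreeGroup (Fin n)) :
    act φ (ofElement g) = ofElement (φ g) := map_ofElement φ g

/-- Two automorphisms that differ by an inner automorphism act equally on cyclic words; it suffices
to compare them on the generators. -/
theorem act_eq_of_conj {φ ψ : MulAut (FreeGroup (Fin n))} (c : FreeGroup (Fin n))
    (h : ∀ i, φ (FreeGroup.of i) = c * ψ (FreeGroup.of i) * c⁻¹) : act φ = act ψ := by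
  have key : φ.toMonoidHom = (MulAut.conj c * ψ).toMonoidHom := by
    ext i
    simpa using h i
  ext1 w
  obtain ⟨L, -, rfl⟩ := exists_eq_ofElement_mk w
  rw [act_ofElement, act_ofElement]
  have : φ (FreeGroup.mk L) = c * ψ (FreeGroup.mk L) * c⁻¹ := DFunLike.congr_fun key _
  rw [this, ofElement_conj]

theorem act_eq_of_eq_on_of {φ ψ : MulAut (FreeGroup (Fin n))}
    (h : ∀ i, φ (FreeGroup.of i) = ψ (FreeGroup.of i)) : act φ = act ψ :=
  act_eq_of_conj 1 (by simpa using h)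

theorem act_conj (c : FreeGroup (Fin n)) : act (MulAut.conj c) = 1 := by
  rw [← _root_.map_one act]
  exact act_eq_of_conj c (by simp)

end action

end CyclicWord

/-! ### Elementary automorphisms and their relations in `Out F₂` -/

namespace CyclicWord

section automorphisms

/-- The automorphism `x₁ ↔ x₂` of `F₂`. -/
def swap : MulAut (FreeGroup (Fin 2)) := FreeGroup.freeGroupCongr (Equiv.swap 0 1)

/-- The automorphism `x₁ ↦ x₁`, `x₂ ↦ x₂⁻¹` of `F₂`. -/
def flip : MulAut (FreeGroup (Fin 2)) :=
  MonoidHom.toMulEquiv (FreeGroup.lift ![FreeGroup.of 0, (FreeGroup.of 1)⁻¹])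
    (FreeGroup.lift ![FreeGroup.of 0, (FreeGroup.of 1)⁻¹])
    (by ext i; fin_cases i <;> simp) (by ext i; fin_cases i <;> simp)

/-- The automorphism `x₁ ↦ x₁ x₂ᵗ`, `x₂ ↦ x₂` of `F₂`. -/
def transvection (t : ℤ) : MulAut (FreeGroup (Fin 2)) :=
  MonoidHom.toMulEquiv (FreeGroup.lift ![FreeGroup.of 0 * FreeGroup.of 1 ^ t, FreeGroup.of 1])
    (FreeGroup.lift ![FreeGroup.of 0 * FreeGroup.of 1 ^ (-t), FreeGroup.of 1])
    (by ext i; fin_cases i <;> simp) (by ext i; fin_cases i <;> simp)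

@[simp] theorem swap_of_zero : swap (FreeGroup.of 0) = FreeGroup.of 1 := by simp [swap]
@[simp] theorem swap_of_one : swap (FreeGroup.of 1) = FreeGroup.of 0 := by simp [swap]
@[simp] theorem flip_of_zero : flip (FreeGroup.of 0) = FreeGroup.of 0 := by simp [flip]
@[simp] theorem flip_of_one : flip (FreeGroup.of 1) = (FreeGroup.of 1)⁻¹ := by simp [flip]
@[simp] theorem transvection_of_zero (t : ℤ) :
    transvection t (FreeGroup.of 0) = FreeGroup.of 0 * FreeGroup.of 1 ^ t := by
  simp [transvection]
@[simp] theorem transvection_of_one (t : ℤ) :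
    transvection t (FreeGroup.of 1) = FreeGroup.of 1 := by
  simp [transvection]

theorem act_swap_mul_self : act swap * act swap = 1 := by
  rw [← _root_.map_mul, ← _root_.map_one act]
  exact act_eq_of_eq_on_of fun i => by fin_cases i <;> simp

theorem act_flip_mul_self : act flip * act flip = 1 := by
  rw [← _root_.map_mul, ← _root_.map_one act]
  exact act_eq_of_eq_on_of fun i => by fin_cases i <;> simp

theorem act_swap_flip_comm :
    act flip * act swap * act flip * act swap = act swap * act flip * act swap * act flip := by
  simp only [← _root_.map_mul]
  exact act_eq_of_eq_on_of fun i => by fin_cases i <;> simp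

theorem act_transvection_add (s t : ℤ) :
    act (transvection (s + t)) = act (transvection s) * act (transvection t) := by
  rw [← _root_.map_mul]
  exact act_eq_of_eq_on_of fun i => by fin_cases i <;> simp [zpow_add, mul_assoc]

theorem act_transvection_zero : act (transvection 0) = 1 := by
  rw [← _root_.map_one act]
  exact act_eq_of_eq_on_of fun i => by fin_cases i <;> simp

theorem act_transvection_neg (t : ℤ) :
    act (transvection (-t)) = (act (transvection t))⁻¹ := by
  rw [eq_inv_iff_mul_eq_one, ← act_transvection_add, neg_add_cancel, act_transvection_zero]

theorem act_flip_conj_transvection (t : ℤ) :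
    act flip * act (transvection t) * act flip = (act (transvection t))⁻¹ := by
  rw [← act_transvection_neg]
  simp only [← _root_.map_mul]
  exact act_eq_of_eq_on_of fun i => by fin_cases i <;> simp

/-- The sign change of `x₁` is the conjugate of `flip` by `swap`. -/
theorem act_flip_conj_transvection' (t : ℤ) :
    (act swap * act flip * act swap) * act (transvection t) * (act swap * act flip * act swap) =
      (act (transvection t))⁻¹ := by
  rw [← act_transvection_neg]
  simp only [← _root_.map_mul]
  refine act_eq_of_conj (FreeGroup.of 1 ^ (-t)) fun i => ?_
  fin_cases i <;> simp <;> group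

/-- The three bases `{x₁, x₂}`, `{x₁x₂, x₂}`, `{x₁, x₁x₂}` pairwise share an element up to
conjugation; this is the relation between the corresponding automorphisms. -/
theorem act_triangle :
    (act (transvection 1))⁻¹ * (act swap * act (transvection 1) * act swap) =
      act flip * act swap * act (transvection 1) := by
  rw [← act_transvection_neg]
  simp only [← _root_.map_mul]
  refine act_eq_of_conj (FreeGroup.of 1) fun i => ?_
  fin_cases i <;> simp [mul_assoc]

end automorphisms

end CyclicWord

/-! ### A normal form in a group generated by two involutions and a transvection -/

section groups

variable {G : Type*} [Group G] {s d a : G}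

/-- If `s`, `d`, `a` satisfy the relations that hold between the swap, a sign change and a
transvection in `Out F₂`, then every element of the subgroup that they generate is a product of a
signed permutation (in the subgroup generated by `s` and `d`), a positive word in the two
transvections `a` and `s * a * s`, and possibly `d`. -/
theorem exists_signed_mul_positive_of_mem_closure (hs : s * s = 1) (hd : d * d = 1)
    (hda : d * a * d = a⁻¹) (hda' : (s * d * s) * a * (s * d * s) = a⁻¹)
    (htri : a⁻¹ * (s * a * s) = d * s * a) {g : G} (hg : g ∈ Subgroup.closure {s, d, a}) :
    ∃ σ ∈ Subgroup.closure {s, d}, ∃ w ∈ Submonoid.closure {a, s * a * s}, ∃ η : G,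
      (η = 1 ∨ η = d) ∧ g = σ * w * η := by
  have hs' : s⁻¹ = s := inv_eq_of_mul_eq_one_left hs
  have hd' : d⁻¹ = d := inv_eq_of_mul_eq_one_left hd
  have hsS : s ∈ Subgroup.closure {s, d} := Subgroup.subset_closure (by simp)
  have hdS : d ∈ Subgroup.closure {s, d} := Subgroup.subset_closure (by simp)
  have haM : a ∈ Submonoid.closure {a, s * a * s} := Submonoid.subset_closure (by simp)
  have hbM : s * a * s ∈ Submonoid.closure {a, s * a * s} := Submonoid.subset_closure (by simp)
  have hss : ∀ x : G, s * (s * x) = x := fun x => by rw [← mul_assoc, hs, one_mul]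
  have hdd : ∀ x : G, d * (d * x) = x := fun x => by rw [← mul_assoc, hd, one_mul]
  have hdai : d * a⁻¹ * d = a := by
    rw [← hda]; simp only [mul_assoc, hdd, hd, mul_one]
  have hdb : d * (s * a * s) * d = s * a⁻¹ * s := by
    rw [← hda']; simp only [mul_assoc, hss, hs, mul_one]
  have hdbi : d * (s * a⁻¹ * s) * d = s * a * s := by
    rw [← hdb]; simp only [mul_assoc, hdd, hd, mul_one]
  have htri' : s * a⁻¹ * s * a = s * d * (s * a * s) := by
    have : s * (a⁻¹ * (s * a * s)) * s = s * (d * s * a) * s := by rw [htri]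
    simpa only [mul_assoc, hss, hs, mul_one] using this
  -- conjugation by a signed permutation permutes the four transvections
  have hconj : ∀ σ ∈ Subgroup.closure {s, d}, ∀ x : G,
      (x = a ∨ x = a⁻¹ ∨ x = s * a * s ∨ x = s * a⁻¹ * s) →
      (σ⁻¹ * x * σ = a ∨ σ⁻¹ * x * σ = a⁻¹ ∨ σ⁻¹ * x * σ = s * a * s ∨
        σ⁻¹ * x * σ = s * a⁻¹ * s) := by
    intro σ hσ
    have hgen : ∀ y ∈ ({s, d} : Set G), ∀ x : G,
        (x = a ∨ x = a⁻¹ ∨ x = s * a * s ∨ x = s * a⁻¹ * s) →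
        (y * x * y = a ∨ y * x * y = a⁻¹ ∨ y * x * y = s * a * s ∨
          y * x * y = s * a⁻¹ * s) := by
      rintro y (rfl | rfl) x (rfl | rfl | rfl | rfl)
      · simp
      · simp
      · left; simp only [mul_assoc, hss, hs, mul_one]
      · right; left; simp only [mul_assoc, hss, hs, mul_one]
      · simp [hda]
      · simp [hdai]
      · simp [hdb]
      · simp [hdbi]
    have hinv : ∀ y ∈ ({s, d} : Set G), y⁻¹ = y := by rintro y (rfl | rfl) <;> assumption
    induction hσ using Subgroup.closure_induction_left with
    | one => intro x hx; simpa using hx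
    | mul_left y hy z _ ih =>
      intro x hx
      have := ih _ (hgen y hy x hx)
      rw [mul_inv_rev, hinv y hy]
      simpa only [mul_assoc] using this
    | inv_mul_cancel y hy z _ ih =>
      intro x hx
      have := ih _ (hgen y hy x hx)
      rw [mul_inv_rev, hinv y hy, hinv y hy]
      simpa only [mul_assoc] using this
  -- multiplication by a transvection preserves the normal form `w * η` up to a signed permutation
  have hstep : ∀ x : G, (x = a ∨ x = a⁻¹ ∨ x = s * a * s ∨ x = s * a⁻¹ * s) →
      ∀ w ∈ Submonoid.closure {a, s * a * s}, ∀ η : G, (η = 1 ∨ η = d) →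
      ∃ σ ∈ Subgroup.closure {s, d}, ∃ w' ∈ Submonoid.closure {a, s * a * s}, ∃ η' : G,
        (η' = 1 ∨ η' = d) ∧ x * w * η = σ * w' * η' := by
    have hdη : ∀ η : G, (η = 1 ∨ η = d) → (d * η = 1 ∨ d * η = d) := by
      rintro η (rfl | rfl)
      · simp
      · simp [hd]
    rintro x (rfl | rfl | rfl | rfl) w hw η hη
    · exact ⟨1, one_mem _, _, mul_mem haM hw, η, hη, by rw [one_mul]⟩
    · induction hw using Submonoid.closure_induction_left with
      | one =>
        refine ⟨d, hdS, a, haM, d * η, hdη η hη, ?_⟩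
        rw [← hda]
        simp only [mul_assoc, one_mul]
      | mul_left y hy z hz _ =>
        rcases hy with rfl | rfl
        · exact ⟨1, one_mem _, z, hz, η, hη, by group⟩
        · refine ⟨d * s, mul_mem hdS hsS, a * z, mul_mem haM hz, η, hη, ?_⟩
          rw [← mul_assoc (a⁻¹), htri]
          simp only [mul_assoc]
    · exact ⟨1, one_mem _, _, mul_mem hbM hw, η, hη, by rw [one_mul]⟩
    · induction hw using Submonoid.closure_induction_left with
      | one =>
        refine ⟨d, hdS, s * a * s, hbM, d * η, hdη η hη, ?_⟩
        rw [← hdb]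
        simp only [mul_assoc, one_mul]
      | mul_left y hy z hz _ =>
        rcases hy with rfl | rfl
        · refine ⟨s * d, mul_mem hsS hdS, (s * y * s) * z, mul_mem hbM hz, η, hη, ?_⟩
          rw [← mul_assoc (s * y⁻¹ * s), htri']
          simp only [mul_assoc]
        · refine ⟨1, one_mem _, z, hz, η, hη, ?_⟩
          simp only [mul_assoc, hss, inv_mul_cancel_left, one_mul]
  have htrans : ∀ x : G, (x = a ∨ x = a⁻¹ ∨ x = s * a * s ∨ x = s * a⁻¹ * s) → ∀ g : G,
      (∃ σ ∈ Subgroup.closure {s, d}, ∃ w ∈ Submonoid.closure {a, s * a * s}, ∃ η : G,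
        (η = 1 ∨ η = d) ∧ g = σ * w * η) →
      ∃ σ ∈ Subgroup.closure {s, d}, ∃ w ∈ Submonoid.closure {a, s * a * s}, ∃ η : G,
        (η = 1 ∨ η = d) ∧ x * g = σ * w * η := by
    rintro x hx _ ⟨σ, hσ, w, hw, η, hη, rfl⟩
    obtain ⟨σ', hσ', w', hw', η', hη', h⟩ := hstep _ (hconj σ hσ x hx) w hw η hη
    refine ⟨σ * σ', mul_mem hσ hσ', w', hw', η', hη', ?_⟩
    calc x * (σ * w * η) = σ * (σ⁻¹ * x * σ * w * η) := by group
      _ = σ * σ' * w' * η' := by rw [h]; simp only [mul_assoc]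
  have hperm : ∀ x ∈ Subgroup.closure {s, d}, ∀ g : G,
      (∃ σ ∈ Subgroup.closure {s, d}, ∃ w ∈ Submonoid.closure {a, s * a * s}, ∃ η : G,
        (η = 1 ∨ η = d) ∧ g = σ * w * η) →
      ∃ σ ∈ Subgroup.closure {s, d}, ∃ w ∈ Submonoid.closure {a, s * a * s}, ∃ η : G,
        (η = 1 ∨ η = d) ∧ x * g = σ * w * η := by
    rintro x hx _ ⟨σ, hσ, w, hw, η, hη, rfl⟩
    exact ⟨x * σ, mul_mem hx hσ, w, hw, η, hη, by simp only [mul_assoc]⟩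
  induction hg using Subgroup.closure_induction_left with
  | one => exact ⟨1, one_mem _, 1, one_mem _, 1, Or.inl rfl, by simp⟩
  | mul_left x hx g _ ih =>
    rcases hx with rfl | rfl | rfl
    · exact hperm _ hsS _ ih
    · exact hperm _ hdS _ ih
    · exact htrans _ (Or.inl rfl) _ ih
  | inv_mul_cancel x hx g _ ih =>
    rcases hx with rfl | rfl | rfl
    · exact hperm _ (inv_mem hsS) _ ih
    · exact hperm _ (inv_mem hdS) _ ih
    · exact htrans _ (Or.inr (Or.inl rfl)) _ ih

/-- The subgroup generated by two involutions `s`, `d` with `(s * d) ^ 4 = 1` consists of the eight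
elements `s ^ i * (s * d * s) ^ k * d ^ j`. -/
theorem exists_eq_of_mem_closure_pair (hs : s * s = 1) (hd : d * d = 1)
    (hsd : d * s * d * s = s * d * s * d) {g : G} (hg : g ∈ Subgroup.closure {s, d}) :
    ∃ i k j : Bool, g = cond i s 1 * cond k (s * d * s) 1 * cond j d 1 := by
  have hss : ∀ x : G, s * (s * x) = x := fun x => by rw [← mul_assoc, hs, one_mul]
  have hdd : ∀ x : G, d * (d * x) = x := fun x => by rw [← mul_assoc, hd, one_mul]
  have h : d * (s * (d * s)) = s * (d * (s * d)) := by simpa only [mul_assoc] using hsd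
  have h' : d * (s * (d * (s * d))) = s * (d * s) := by
    have : d * s * d * s * d = s * d * s := by rw [hsd, mul_assoc, hd, mul_one]
    simpa only [mul_assoc] using this
  have hinv : ∀ y ∈ ({s, d} : Set G), y⁻¹ = y := by
    rintro y (rfl | rfl)
    · exact inv_eq_of_mul_eq_one_left hs
    · exact inv_eq_of_mul_eq_one_left hd
  have hmul : ∀ y ∈ ({s, d} : Set G), ∀ g : G,
      (∃ i k j : Bool, g = cond i s 1 * cond k (s * d * s) 1 * cond j d 1) →
      ∃ i k j : Bool, y * g = cond i s 1 * cond k (s * d * s) 1 * cond j d 1 := by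
    rintro y (rfl | rfl) _ ⟨i, k, j, rfl⟩
    · refine ⟨!i, k, j, ?_⟩
      cases i <;> simp [mul_assoc, hss]
    · cases i
      · refine ⟨false, k, !j, ?_⟩
        cases k <;> cases j <;> simp [hd, mul_assoc, h, h']
      · refine ⟨true, !k, j, ?_⟩
        cases k <;> cases j <;> simp [mul_assoc, hss, hdd]
  induction hg using Subgroup.closure_induction_left with
  | one => exact ⟨false, false, false, by simp⟩
  | mul_left x hx g _ ih => exact hmul x hx g ih
  | inv_mul_cancel x hx g _ ih => rw [hinv x hx]; exact hmul x hx g ih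

end groups

/-! ### Cancellation in free groups -/

namespace FreeGroup

section norm

variable {α : Type*}

theorem exists_maximal_common_prefix (L M : List (α × Bool)) :
    ∃ P X Y : List (α × Bool), L = P ++ X ∧ M = P ++ Y ∧
      ∀ a ∈ X.head?, ∀ b ∈ Y.head?, a ≠ b := by
  induction L generalizing M with
  | nil => exact ⟨[], [], M, rfl, rfl, by simp⟩
  | cons a L ih =>
    cases M with
    | nil => exact ⟨[], a :: L, [], rfl, rfl, by simp⟩
    | cons b M =>
      by_cases h : a = b
      · obtain ⟨P, X, Y, rfl, rfl, hXY⟩ := ih M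
        exact ⟨a :: P, X, Y, rfl, by simp [h], hXY⟩
      · exact ⟨[], a :: L, b :: M, rfl, rfl, by simpa using h⟩

theorem IsReduced.invRev {L : List (α × Bool)} (h : IsReduced L) : IsReduced (invRev L) := by
  classical
  rw [isReduced_iff_reduce_eq] at h ⊢
  rw [reduce_invRev, h]

theorem IsReduced.invRev_append {X Y : List (α × Bool)} (hX : IsReduced X) (hY : IsReduced Y)
    (hXY : ∀ a ∈ X.head?, ∀ b ∈ Y.head?, a ≠ b) : IsReduced (FreeGroup.invRev X ++ Y) := by
  rw [IsReduced, List.isChain_append]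
  refine ⟨hX.invRev, hY, fun a ha b hb h1 => ?_⟩
  cases X with
  | nil => simp at ha
  | cons c X =>
    have hcb := hXY c (by simp) b hb
    rw [invRev_cons] at ha
    simp only [FreeGroup.invRev, List.map_cons, List.map_nil, List.reverse_cons, List.reverse_nil,
      List.nil_append, List.getLast?_concat, Option.mem_some_iff] at ha
    subst ha
    obtain ⟨i, e⟩ := c
    obtain ⟨j, f⟩ := b
    simp only at h1
    subst h1
    cases e <;> cases f <;> simp_all

variable [DecidableEq α]

theorem norm_mk_of_isReduced {L : List (α × Bool)} (h : IsReduced L) :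
    norm (mk L) = L.length := by
  rw [norm, toWord_mk, h.reduce_eq]

/-- The norm of `x⁻¹ * y` measures the longest common prefix of `x` and `y` (their Gromov
product). -/
theorem norm_inv_mul_add_le_iff (x y : FreeGroup α) (k : ℕ) :
    norm (x⁻¹ * y) + 2 * k ≤ norm x + norm y ↔
      k ≤ norm x ∧ k ≤ norm y ∧ x.toWord.take k = y.toWord.take k := by
  obtain ⟨P, X, Y, hx, hy, hXY⟩ := exists_maximal_common_prefix x.toWord y.toWord
  have hrx : IsReduced (P ++ X) := hx ▸ isReduced_toWord
  have hry : IsReduced (P ++ Y) := hy ▸ isReduced_toWord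
  have hn : norm (x⁻¹ * y) = X.length + Y.length := by
    have h1 : x⁻¹ * y = mk (invRev X ++ Y) := by
      rw [← mk_toWord (x := x), ← mk_toWord (x := y), hx, hy, ← mul_mk, ← mul_mk, ← mul_mk,
        ← inv_mk]
      group
    rw [h1, norm_mk_of_isReduced, List.length_append, invRev_length]
    exact (hrx.infix ⟨P, [], by simp⟩).invRev_append (hry.infix ⟨P, [], by simp⟩) hXY
  have hnx : norm x = P.length + X.length := by rw [norm, hx, List.length_append]
  have hny : norm y = P.length + Y.length := by rw [norm, hy, List.length_append]
  rw [hn, hnx, hny, hx, hy]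
  constructor
  · intro h
    have hk : k ≤ P.length := by omega
    exact ⟨by omega, by omega, by rw [List.take_append_of_le_length hk,
      List.take_append_of_le_length hk]⟩
  · rintro ⟨h1, h2, h3⟩
    by_contra! h
    obtain ⟨m, hm⟩ : ∃ m, k = P.length + (m + 1) := ⟨k - P.length - 1, by omega⟩
    rw [hm, List.take_length_add_append, List.take_length_add_append] at h3
    have h3' := List.append_cancel_left h3
    cases X with
    | nil => simp at h1; omega
    | cons a X =>
      cases Y with
      | nil => simp at h2; omega
      | cons b Y => simp at h3' hXY; exact hXY h3'.1

theorem norm_mk_mod_two (L : List (α × Bool)) : norm (mk L) % 2 = L.length % 2 := by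
  obtain ⟨n, hn⟩ := Red.length (reduce.red (L := L))
  rw [norm, toWord_mk]
  omega

theorem norm_mul_mod_two (x y : FreeGroup α) : norm (x * y) % 2 = (norm x + norm y) % 2 := by
  conv_lhs => rw [← mk_toWord (x := x), ← mk_toWord (x := y), mul_mk, norm_mk_mod_two]
  simp [norm]

/-- If `x` and `y` have less of a common prefix than `y` and `z`, then the common prefix of `x` and
`z` is that of `x` and `y`. -/
theorem norm_inv_mul_of_lt {x y z : FreeGroup α}
    (h : norm x + norm (y⁻¹ * z) < norm (x⁻¹ * y) + norm z) :
    norm (x⁻¹ * z) + norm y = norm (x⁻¹ * y) + norm z := by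
  have key : ∀ x y : FreeGroup α, ∃ k : ℕ, norm (x⁻¹ * y) + 2 * k = norm x + norm y := by
    intro x y
    have h1 := norm_mul_mod_two x⁻¹ y
    have h2 := norm_mul_le x⁻¹ y
    rw [norm_inv_eq] at h1 h2
    exact ⟨(norm x + norm y - norm (x⁻¹ * y)) / 2, by omega⟩
  obtain ⟨k₁, hk₁⟩ := key x y
  obtain ⟨k₂, hk₂⟩ := key y z
  obtain ⟨k₃, hk₃⟩ := key x z
  have hk : k₁ < k₂ := by omega
  have t₁ := (norm_inv_mul_add_le_iff x y k₁).1 hk₁.le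
  have t₂ := (norm_inv_mul_add_le_iff y z k₂).1 hk₂.le
  have t₃ := (norm_inv_mul_add_le_iff x z k₃).1 hk₃.le
  have htake : ∀ {L M : List (α × Bool)} {m n : ℕ}, m ≤ n → L.take n = M.take n →
      L.take m = M.take m := fun {L M m n} hmn hL => by
    have := congrArg (List.take m) hL
    rwa [List.take_take, List.take_take, min_eq_left hmn] at this
  have h₁ : k₁ ≤ k₃ := by
    have := (norm_inv_mul_add_le_iff x z k₁).2
      ⟨t₁.1, by omega, t₁.2.2.trans (htake hk.le t₂.2.2)⟩
    omega
  have h₂ : k₃ ≤ k₁ := by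
    by_contra! h₂
    have := (norm_inv_mul_add_le_iff x y (k₁ + 1)).2
      ⟨by omega, by omega, (htake h₂ t₃.2.2).trans (htake hk t₂.2.2).symm⟩
    omega
  omega

theorem norm_lt_norm_mul_self {x : FreeGroup α} (hx : x ≠ 1) : norm x < norm (x * x) := by
  have h1 := reduceCyclically.reduce_flatten_replicate_succ (isReduced_toWord (x := x)) 1
  have h2 := congrArg List.length (reduceCyclically.conj_conjugator_reduceCyclically x.toWord)
  have h3 : (reduceCyclically x.toWord).length ≠ 0 := by
    intro h0
    have h4 := reduceCyclically.conj_conjugator_reduceCyclically x.toWord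
    rw [List.eq_nil_of_length_eq_zero h0, List.append_nil] at h4
    apply hx
    rw [← mk_toWord (x := x), ← h4, ← mul_mk, ← inv_mk, mul_inv_cancel]
  have h5 := congrArg List.length h1
  simp only [List.length_append, invRev_length, List.length_flatten, List.map_replicate,
    List.sum_replicate] at h2 h5
  rw [norm, norm, ← pow_two, toWord_pow, h5, ← h2]
  simp only [smul_eq_mul]
  omega

/-- If half of `v` cancels in each of the products `u * v` and `v * u`, then conjugation brings the
pair `(u * v, v)` to total norm at most the norm of `u`. -/
theorem exists_conj_norm_add_le {u v : FreeGroup α} (h₁ : norm (u * v) = norm u)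
    (h₂ : norm (v * u) = norm u) (h₃ : norm v ≤ norm u) :
    ∃ c : FreeGroup α, norm (c * (u * v) * c⁻¹) + norm (c * v * c⁻¹) ≤ norm u := by
  have hpar := norm_mul_mod_two u v
  obtain ⟨h, hh⟩ : ∃ h, norm v = 2 * h := ⟨norm v / 2, by omega⟩
  have k₁ := (norm_inv_mul_add_le_iff u⁻¹ v h).1 (by rw [inv_inv, norm_inv_eq]; omega)
  have k₂ := (norm_inv_mul_add_le_iff v⁻¹ u h).1 (by rw [inv_inv, norm_inv_eq]; omega)
  have hVlen : v.toWord.length = 2 * h := hh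
  have hUlen : 2 * h ≤ u.toWord.length := hh ▸ h₃
  -- `v = P R` and `u = R⁻¹ N⁻¹ P⁻¹` without cancellation
  obtain ⟨P, R, hV, hP⟩ : ∃ P R, v.toWord = P ++ R ∧ P.length = h :=
    ⟨_, _, (List.take_append_drop h _).symm, by rw [List.length_take]; omega⟩
  have hR : (invRev R).length = h := by
    rw [hV, List.length_append] at hVlen
    rw [invRev_length]; omega
  obtain ⟨M, hM⟩ : ∃ M, u.toWord = invRev R ++ M := by
    refine ⟨u.toWord.drop h, ?_⟩
    conv_lhs => rw [← List.take_append_drop h u.toWord]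
    rw [← k₂.2.2, toWord_inv, hV, invRev_append, List.take_left' hR]
  have hMlen : h ≤ (invRev M).length := by
    rw [hM, List.length_append] at hUlen
    rw [invRev_length]; omega
  obtain ⟨N, hN⟩ : ∃ N, invRev M = P ++ N := by
    refine ⟨(invRev M).drop h, ?_⟩
    conv_lhs => rw [← List.take_append_drop h (invRev M)]
    rw [← List.take_append_of_le_length (l₂ := R) hMlen]
    have := k₁.2.2
    rw [toWord_inv, hM, invRev_append, invRev_invRev, hV, List.take_left' hP] at this
    rw [this]
  have hM' : M = invRev N ++ invRev P := by rw [← invRev_append, ← hN, invRev_invRev]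
  have hv : v = mk P * mk R := by rw [mul_mk, ← hV, mk_toWord]
  have hu : u = (mk R)⁻¹ * (mk N)⁻¹ * (mk P)⁻¹ := by
    rw [inv_mk, inv_mk, inv_mk, mul_mk, mul_mk, List.append_assoc, ← hM', ← hM, mk_toWord]
  refine ⟨mk R, ?_⟩
  have e₁ : mk R * (u * v) * (mk R)⁻¹ = (mk N)⁻¹ := by rw [hu, hv]; group
  have e₂ : mk R * v * (mk R)⁻¹ = mk (R ++ P) := by rw [hv, ← mul_mk]; group
  have n₁ : norm (mk N) ≤ N.length := norm_mk_le
  have n₂ : norm (mk (R ++ P)) ≤ (R ++ P).length := norm_mk_le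
  have n₃ : norm u = u.toWord.length := rfl
  rw [hM, hM'] at n₃
  simp only [List.length_append, invRev_length] at n₂ n₃ hR
  rw [e₁, e₂, norm_inv_eq]
  omega

end norm

end FreeGroup

/-! ### Nielsen's theorem in rank two -/

namespace CyclicWord

section generation

/-- The subgroup of `Aut F₂` generated by the inner automorphisms and by the elementary Nielsen
automorphisms; it is everything, see `nielsen_eq_top`. -/
def nielsen : Subgroup (MulAut (FreeGroup (Fin 2))) :=
  Subgroup.closure ({swap, flip, transvection 1} ∪ Set.range MulAut.conj)

theorem swap_mem_nielsen : swap ∈ nielsen := Subgroup.subset_closure (by simp)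
theorem flip_mem_nielsen : flip ∈ nielsen := Subgroup.subset_closure (by simp)
theorem transvection_mem_nielsen : transvection 1 ∈ nielsen := Subgroup.subset_closure (by simp)
theorem conj_mem_nielsen (c : FreeGroup (Fin 2)) : MulAut.conj c ∈ nielsen :=
  Subgroup.subset_closure (by simp)

theorem exists_mem_nielsen_of_letters (k l : Letter 2) (hkl : k.1 ≠ l.1) :
    ∃ σ ∈ nielsen, σ (FreeGroup.of 0) = FreeGroup.mk [k] ∧
      σ (FreeGroup.of 1) = FreeGroup.mk [l] := by
  have hs := swap_mem_nielsen
  have hd := flip_mem_nielsen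
  have hinv : ∀ i : Fin 2, FreeGroup.mk [(i, false)] = (FreeGroup.of i)⁻¹ := fun i => rfl
  have hof : ∀ i : Fin 2, FreeGroup.mk [(i, true)] = FreeGroup.of i := fun i => rfl
  obtain ⟨i, e⟩ := k
  obtain ⟨j, f⟩ := l
  have h1 : ∃ δ ∈ nielsen, δ (FreeGroup.of 0) = FreeGroup.mk [(0, e)] ∧
      δ (FreeGroup.of 1) = FreeGroup.of 1 := by
    cases e
    · exact ⟨swap * flip * swap, mul_mem (mul_mem hs hd) hs, by simp [hinv], by simp⟩
    · exact ⟨1, one_mem _, by simp [hof], by simp⟩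
  have h2 : ∃ δ ∈ nielsen, δ (FreeGroup.of 1) = FreeGroup.mk [(1, f)] ∧
      δ (FreeGroup.of 0) = FreeGroup.of 0 := by
    cases f
    · exact ⟨flip, hd, by simp [hinv], by simp⟩
    · exact ⟨1, one_mem _, by simp [hof], by simp⟩
  have h1' : ∃ δ ∈ nielsen, δ (FreeGroup.of 0) = FreeGroup.mk [(0, f)] ∧
      δ (FreeGroup.of 1) = FreeGroup.of 1 := by
    cases f
    · exact ⟨swap * flip * swap, mul_mem (mul_mem hs hd) hs, by simp [hinv], by simp⟩
    · exact ⟨1, one_mem _, by simp [hof], by simp⟩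
  have h2' : ∃ δ ∈ nielsen, δ (FreeGroup.of 1) = FreeGroup.mk [(1, e)] ∧
      δ (FreeGroup.of 0) = FreeGroup.of 0 := by
    cases e
    · exact ⟨flip, hd, by simp [hinv], by simp⟩
    · exact ⟨1, one_mem _, by simp [hof], by simp⟩
  obtain ⟨δ, hδ, a, b⟩ := h1
  obtain ⟨ε, hε, c, d⟩ := h2
  obtain ⟨δ', hδ', a', b'⟩ := h1'
  obtain ⟨ε', hε', c', d'⟩ := h2'
  have hfix : ∀ b : Bool, ε' (FreeGroup.mk [(0, b)]) = FreeGroup.mk [(0, b)] ∧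
      ε (FreeGroup.mk [(0, b)]) = FreeGroup.mk [(0, b)] := by
    intro b
    cases b <;> simp [hinv, hof, d, d']
  fin_cases i <;> fin_cases j
  · exact absurd rfl hkl
  · exact ⟨ε * δ, mul_mem hε hδ, by simp [a, hfix], by simp [b, c]⟩
  · refine ⟨ε' * δ' * swap, mul_mem (mul_mem hε' hδ') hs, by simp [b', c'], by simp [a', hfix]⟩
  · exact absurd rfl hkl

open FreeGroup

variable (φ : MulAut (FreeGroup (Fin 2)))

/-- A basis of `F₂`, the image of the standard one under `φ`, is minimal if its total norm cannot
be decreased by Nielsen automorphisms and conjugation. -/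
def IsNielsenMinimal : Prop :=
  ∀ κ ∈ nielsen, ∀ σ ∈ nielsen, norm (φ (of 0)) + norm (φ (of 1)) ≤
    norm ((κ * φ * σ) (of 0)) + norm ((κ * φ * σ) (of 1))

variable {φ}

theorem norm_apply_mk_letters (k l : Letter 2) (hkl : k.1 ≠ l.1) :
    norm (φ (mk [k])) + norm (φ (mk [l])) = norm (φ (of 0)) + norm (φ (of 1)) := by
  have hof : ∀ (i : Fin 2) (b : Bool), norm (φ (mk [(i, b)])) = norm (φ (of i)) := by
    intro i b
    cases b
    · have : mk [(i, false)] = (of i)⁻¹ := rfl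
      rw [this, _root_.map_inv, norm_inv_eq]
    · rfl
  obtain ⟨i, e⟩ := k
  obtain ⟨j, f⟩ := l
  rw [hof, hof]
  fin_cases i <;> fin_cases j
  · exact absurd rfl hkl
  · rfl
  · exact add_comm _ _
  · exact absurd rfl hkl

theorem IsNielsenMinimal.le_conj_mul (h : IsNielsenMinimal φ) (c : FreeGroup (Fin 2))
    (k l : Letter 2) (hkl : k.1 ≠ l.1) :
    norm (φ (mk [k])) + norm (φ (mk [l])) ≤
      norm (c * (φ (mk [k]) * φ (mk [l])) * c⁻¹) + norm (c * φ (mk [l]) * c⁻¹) := by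
  obtain ⟨σ, hσ, h0, h1⟩ := exists_mem_nielsen_of_letters k l hkl
  have := h _ (conj_mem_nielsen c) _ (mul_mem hσ transvection_mem_nielsen)
  rw [norm_apply_mk_letters k l hkl]
  have e : c * (φ (mk [k]) * φ (mk [l])) * c⁻¹ =
      c * φ (mk [k]) * c⁻¹ * (c * φ (mk [l]) * c⁻¹) := by group
  rw [e]
  simpa only [MulAut.mul_apply, transvection_of_zero, transvection_of_one, zpow_one, h0, h1,
    MulAut.conj_apply, _root_.map_mul] using this

theorem IsNielsenMinimal.le_mul (h : IsNielsenMinimal φ) (k l : Letter 2) (hkl : k.1 ≠ l.1) :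
    norm (φ (mk [k])) ≤ norm (φ (mk [k]) * φ (mk [l])) := by
  have := h.le_conj_mul 1 k l hkl
  simp only [one_mul, inv_one, mul_one] at this
  omega

theorem mk_singleton_inv (i : Fin 2) (e : Bool) :
    (mk [(i, e)] : FreeGroup (Fin 2))⁻¹ = mk [(i, !e)] := by
  rw [inv_mk]; rfl

theorem IsNielsenMinimal.le_mul' (h : IsNielsenMinimal φ) (k l : Letter 2) (hkl : k.1 ≠ l.1) :
    norm (φ (mk [l])) ≤ norm (φ (mk [k]) * φ (mk [l])) := by
  have := h.le_mul (l.1, !l.2) (k.1, !k.2) hkl.symm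
  rwa [← mk_singleton_inv, ← mk_singleton_inv, _root_.map_inv, _root_.map_inv, ← mul_inv_rev,
    norm_inv_eq, norm_inv_eq] at this

theorem apply_mk_singleton_ne_one (k : Letter 2) : φ (mk [k]) ≠ 1 := by
  rw [ne_eq, EmbeddingLike.map_eq_one_iff, ← FreeGroup.norm_eq_zero,
    norm_mk_of_isReduced .singleton]
  simp

theorem IsNielsenMinimal.le_mul_of_isReduced (h : IsNielsenMinimal φ) {k l : Letter 2}
    (hkl : k.1 = l.1 → k.2 = l.2) :
    norm (φ (mk [k])) ≤ norm (φ (mk [k]) * φ (mk [l])) ∧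
      norm (φ (mk [l])) ≤ norm (φ (mk [k]) * φ (mk [l])) := by
  by_cases hk : k.1 = l.1
  · have : k = l := Prod.ext hk (hkl hk)
    subst this
    have := norm_lt_norm_mul_self (apply_mk_singleton_ne_one (φ := φ) k)
    exact ⟨this.le, this.le⟩
  · exact ⟨h.le_mul k l hk, h.le_mul' k l hk⟩

/-- In a minimal basis, no factor of a reduced product is cancelled completely by its two
neighbours. -/
theorem IsNielsenMinimal.lt_triple (h : IsNielsenMinimal φ) {k l m : Letter 2}
    (hkl : k.1 = l.1 → k.2 = l.2) (hlm : l.1 = m.1 → l.2 = m.2) :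
    norm (φ (mk [k])) + norm (φ (mk [m])) <
      norm (φ (mk [k]) * φ (mk [l])) + norm (φ (mk [l]) * φ (mk [m])) := by
  have h1 := h.le_mul_of_isReduced hkl
  have h2 := h.le_mul_of_isReduced hlm
  by_contra! hle
  have e1 : norm (φ (mk [k]) * φ (mk [l])) = norm (φ (mk [k])) := by omega
  have e2 : norm (φ (mk [l]) * φ (mk [m])) = norm (φ (mk [m])) := by omega
  have hne : k.1 ≠ l.1 := by
    intro hk
    have : k = l := Prod.ext hk (hkl hk)
    subst this
    have := norm_lt_norm_mul_self (apply_mk_singleton_ne_one (φ := φ) k)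
    omega
  have hne' : l.1 ≠ m.1 := by
    intro hk
    have : l = m := Prod.ext hk (hlm hk)
    subst this
    have := norm_lt_norm_mul_self (apply_mk_singleton_ne_one (φ := φ) l)
    omega
  have hkm : m.1 = k.1 := by omega
  by_cases hs : m.2 = k.2
  · have : m = k := Prod.ext hkm hs
    subst this
    obtain ⟨c, hc⟩ := exists_conj_norm_add_le e1 e2 (by omega)
    have h3 := h.le_conj_mul c m l hne
    have h4 := mt FreeGroup.norm_eq_zero.1 (apply_mk_singleton_ne_one (φ := φ) l)
    omega
  · have hm : φ (mk [m]) = (φ (mk [k]))⁻¹ := by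
      obtain ⟨i, e⟩ := k
      obtain ⟨j, f⟩ := m
      simp only at hkm hs
      rw [← _root_.map_inv, mk_singleton_inv, hkm]
      congr 4
      cases e <;> cases f <;> simp_all
    rw [hm] at e2
    -- `v` and `v⁻¹` share at least half of their letters with the same word
    have h4 := norm_lt_norm_mul_self (apply_mk_singleton_ne_one (φ := φ) l)
    have hpar := norm_mul_mod_two (φ (mk [k])) (φ (mk [l]))
    rw [norm_inv_eq] at e2
    set K := φ (mk [k])
    set V := φ (mk [l])
    have h5 := (norm_inv_mul_add_le_iff V⁻¹ K⁻¹ (V.norm / 2)).1 (by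
      rw [inv_inv, norm_inv_eq, norm_inv_eq]; omega)
    have h6 := (norm_inv_mul_add_le_iff K⁻¹ V (V.norm / 2)).1 (by
      rw [inv_inv, norm_inv_eq]; omega)
    have h7 := (norm_inv_mul_add_le_iff V⁻¹ V (V.norm / 2)).2
      ⟨h5.1, h6.2.1, h5.2.2.trans h6.2.2⟩
    rw [inv_inv, norm_inv_eq] at h7
    omega

theorem apply_mk_cons (k : Letter 2) (L : List (Letter 2)) :
    φ (mk (k :: L)) = φ (mk [k]) * φ (mk L) := by
  rw [← _root_.map_mul, mul_mk, List.singleton_append]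

/-- In a minimal basis, cancellation in a reduced product only takes place between neighbouring
factors. -/
theorem IsNielsenMinimal.norm_apply_mk_cons_cons (h : IsNielsenMinimal φ) (k l : Letter 2)
    (L : List (Letter 2)) (hL : IsReduced (k :: l :: L)) :
    norm (φ (mk (k :: l :: L))) + norm (φ (mk [l])) =
      norm (φ (mk [k]) * φ (mk [l])) + norm (φ (mk (l :: L))) := by
  induction L generalizing k l with
  | nil => rw [apply_mk_cons k]
  | cons m L ih =>
    rw [isReduced_cons_cons] at hL
    have hlm := isReduced_cons_cons.1 hL.2
    have h1 := ih l m hL.2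
    have h2 := h.lt_triple hL.1 hlm.1
    have h3 := norm_inv_mul_of_lt (x := (φ (mk [k]))⁻¹) (y := φ (mk [l]))
      (z := φ (mk (l :: m :: L))) (by
        rw [apply_mk_cons l (m :: L), inv_mul_cancel_left, ← apply_mk_cons l, inv_inv, norm_inv_eq]
        omega)
    rwa [inv_inv, ← apply_mk_cons k] at h3

/-- In a minimal basis, the norm of a reduced product is nondecreasing in the number of factors, so
only single factors can be letters. -/
theorem IsNielsenMinimal.eq_singleton (h : IsNielsenMinimal φ) {L : List (Letter 2)}
    (hL : IsReduced L) (hne : L ≠ []) (h1 : norm (φ (mk L)) ≤ 1) : ∃ k, L = [k] := by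
  induction L with
  | nil => exact absurd rfl hne
  | cons k M ih =>
    cases M with
    | nil => exact ⟨k, rfl⟩
    | cons l L =>
      exfalso
      have hkl := (isReduced_cons_cons.1 hL)
      have h2 := h.norm_apply_mk_cons_cons k l L hL
      have h3 := h.le_mul_of_isReduced hkl.1
      obtain ⟨m, hm⟩ := ih hkl.2 (by simp) (by omega)
      obtain ⟨rfl, rfl⟩ := List.cons_eq_cons.1 hm
      rw [apply_mk_cons k] at h1
      have h4 := norm_mul_mod_two (φ (mk [k])) (φ (mk [l]))
      have h5 := mt FreeGroup.norm_eq_zero.1 (apply_mk_singleton_ne_one (φ := φ) l)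
      have h6 := mt FreeGroup.norm_eq_zero.1 (apply_mk_singleton_ne_one (φ := φ) k)
      omega

theorem IsNielsenMinimal.exists_symm_of (h : IsNielsenMinimal φ) (i : Fin 2) :
    ∃ k : Letter 2, φ⁻¹ (of i) = mk [k] := by
  obtain ⟨k, hk⟩ := h.eq_singleton (L := (φ⁻¹ (of i)).toWord) isReduced_toWord (by
    rw [ne_eq, toWord_eq_nil_iff, EmbeddingLike.map_eq_one_iff]
    exact of_ne_one i) (by rw [mk_toWord, MulAut.apply_inv_self, norm_of])
  exact ⟨k, by rw [← hk, mk_toWord]⟩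

theorem IsNielsenMinimal.mem_nielsen (h : IsNielsenMinimal φ) : φ ∈ nielsen := by
  obtain ⟨k, hk⟩ := h.exists_symm_of 0
  obtain ⟨l, hl⟩ := h.exists_symm_of 1
  have hkl : k.1 ≠ l.1 := by
    intro hkl
    have key : (mk [k] : FreeGroup (Fin 2)) = mk [l] ∨
        (mk [k] : FreeGroup (Fin 2)) = (mk [l])⁻¹ := by
      obtain ⟨i, e⟩ := k
      obtain ⟨j, f⟩ := l
      simp only at hkl
      subst hkl
      rw [mk_singleton_inv]
      cases e <;> cases f <;> simp
    rw [← hk, ← hl, ← _root_.map_inv, EmbeddingLike.apply_eq_iff_eq,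
      EmbeddingLike.apply_eq_iff_eq] at key
    rcases key with key | key
    · exact absurd (of_injective key) (by decide)
    · -- in the abelianization, the exponent sums of `x₁` differ
      have := congrArg (lift ![Multiplicative.ofAdd (1 : ℤ), 1]) key
      simp at this
  obtain ⟨σ, hσ, h0, h1⟩ := exists_mem_nielsen_of_letters k l hkl
  have : φ⁻¹ = σ := by
    have key : φ⁻¹.toMonoidHom = σ.toMonoidHom := by
      ext i
      fin_cases i
      · exact hk.trans h0.symm
      · exact hl.trans h1.symm
    ext1 x
    exact DFunLike.congr_fun key x
  rw [← inv_mem_iff, this]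
  exact hσ

/-- **Nielsen's theorem** for rank two: `Aut F₂` is generated by the elementary Nielsen
automorphisms and the inner automorphisms. -/
theorem nielsen_eq_top : nielsen = ⊤ := by
  rw [eq_top_iff]
  intro φ _
  obtain ⟨N, hN⟩ : ∃ N, norm (φ (of 0)) + norm (φ (of 1)) = N := ⟨_, rfl⟩
  induction N using Nat.strong_induction_on generalizing φ with
  | _ N ih =>
    by_cases h : IsNielsenMinimal φ
    · exact h.mem_nielsen
    · simp only [IsNielsenMinimal, not_forall, not_le] at h
      obtain ⟨κ, hκ, σ, hσ, hlt⟩ := h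
      have := ih _ (hN ▸ hlt) (φ := κ * φ * σ) trivial rfl
      have h' := mul_mem (mul_mem (inv_mem hκ) this) (inv_mem hσ)
      rwa [show κ⁻¹ * (κ * φ * σ) * σ⁻¹ = φ by group] at h'

theorem act_mem_closure (φ : MulAut (FreeGroup (Fin 2))) :
    act φ ∈ Subgroup.closure {act swap, act flip, act (transvection 1)} := by
  have hφ : φ ∈ nielsen := nielsen_eq_top ▸ Subgroup.mem_top φ
  have : nielsen ≤ (Subgroup.closure {act swap, act flip, act (transvection 1)}).comap act := by
    rw [nielsen, Subgroup.closure_le]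
    rintro ψ ((rfl | rfl | rfl) | ⟨c, rfl⟩)
    · exact Subgroup.subset_closure (by simp)
    · exact Subgroup.subset_closure (by simp)
    · exact Subgroup.subset_closure (by simp)
    · rw [SetLike.mem_coe, Subgroup.mem_comap, act_conj]
      exact one_mem _
  exact this hφ

end generation

end CyclicWord

/-! ### Syllables of cyclic words -/

namespace CyclicWord

section lengths

theorem occ_ofElement_mk {L : List (Letter 2)} (h : FreeGroup.IsCyclicallyReduced L) (i : Fin 2) :
    (ofElement (FreeGroup.mk L)).occ i = L.countP fun a => a.1 = i := by
  rw [occ, ofElement_mk_val_of_isCyclicallyReduced h, Cycle.coe_toMultiset, Multiset.coe_countP]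

theorem length_ofElement_mk {L : List (Letter 2)} (h : FreeGroup.IsCyclicallyReduced L) :
    (ofElement (FreeGroup.mk L)).length = L.length := by
  rw [length, ofElement_mk_val_of_isCyclicallyReduced h, Cycle.length_coe]

theorem length_eq_occ_add_occ (w : CyclicWord 2) : w.length = w.occ 0 + w.occ 1 := by
  obtain ⟨L, hL, rfl⟩ := exists_eq_ofElement_mk w
  rw [length_ofElement_mk hL, occ_ofElement_mk hL, occ_ofElement_mk hL,
    List.length_eq_countP_add_countP (fun a : Letter 2 => decide (a.1 = 0))]
  congr 1
  refine List.countP_congr fun a _ => ?_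
  obtain ⟨i, e⟩ := a
  fin_cases i <;> simp

end lengths

section syllables

/-- The word `x₂ᵏ` as a list of letters. -/
def powWord (k : ℤ) : List (Letter 2) := List.replicate k.natAbs (1, decide (0 ≤ k))

/-- A syllable `x₁^ε x₂ᵏ` of a word, followed by a letter `x₁^ε'`, is encoded as `(ε, k, ε')`. -/
abbrev Syllable : Type := Bool × ℤ × Bool

namespace Syllable

/-- The syllable `x₁^ε x₂ᵏ` as a list of letters. -/
def word (g : Syllable) : List (Letter 2) := (0, g.1) :: powWord g.2.1

/-- The rate at which the exponent of `x₂` grows under `x₁ ↦ x₁ x₂ᵗ`. -/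
def slope (g : Syllable) : ℤ := if g.1 = g.2.2 then cond g.1 1 (-1) else 0

/-- The effect of `x₁ ↦ x₁ x₂ᵗ` on a syllable of a cyclic word. -/
def shift (t : ℤ) (g : Syllable) : Syllable := (g.1, g.2.1 + t * g.slope, g.2.2)

/-- `Path e s e'`: the sequence `s` of syllables reads as a reduced word that starts with `x₁^e` and
remains reduced when followed by `x₁^e'`. -/
def Path : Bool → List Syllable → Bool → Prop
  | e, [], e' => e = e'
  | e, g :: s, e' => g.1 = e ∧ (g.1 ≠ g.2.2 → g.2.1 ≠ 0) ∧ Path g.2.2 s e'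

theorem Path.map_shift (t : ℤ) {s : List Syllable} {e e' : Bool} (h : Path e s e') :
    Path e (s.map (shift t)) e' := by
  induction s generalizing e with
  | nil => exact h
  | cons g s ih =>
    refine ⟨h.1, fun hne => ?_, ih h.2.2⟩
    have h2 := h.2.1 hne
    have hne' : g.1 ≠ g.2.2 := hne
    simpa [shift, slope, hne'] using h2

end Syllable

open Syllable

/-- The word read off a sequence of syllables. -/
def flat (s : List Syllable) : List (Letter 2) := s.flatMap word

theorem flat_cons (g : Syllable) (s : List Syllable) :
    flat (g :: s) = (0, g.1) :: (powWord g.2.1 ++ flat s) := rfl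

theorem mk_powWord (k : ℤ) :
    FreeGroup.mk (powWord k) = (FreeGroup.of 1 : FreeGroup (Fin 2)) ^ k := by
  have h : ∀ (n : ℕ) (b : Bool), FreeGroup.mk (List.replicate n ((1, b) : Letter 2)) =
      FreeGroup.mk [(1, b)] ^ n := by
    intro n b
    induction n with
    | zero => rfl
    | succ n ih => rw [List.replicate_succ, pow_succ', ← ih, FreeGroup.mul_mk]; rfl
  rw [powWord, h]
  rcases le_or_gt 0 k with hk | hk
  · obtain ⟨n, rfl⟩ := Int.eq_ofNat_of_zero_le hk
    simp [FreeGroup.of]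
  · obtain ⟨n, rfl⟩ := Int.exists_eq_neg_ofNat hk.le
    have hn : ¬ (0 : ℤ) ≤ -(n : ℤ) := not_le.2 hk
    simp only [hn, decide_false, Int.natAbs_neg, Int.natAbs_natCast, zpow_neg, zpow_natCast]
    rw [← inv_pow]
    rfl

theorem head?_flat_append {s : List Syllable} {e e' : Bool} (h : Path e s e') :
    (flat s ++ [(0, e')]).head? = some (0, e) := by
  cases s with
  | nil => simp [flat, show e = e' from h]
  | cons g s => simp [flat_cons, h.1]

theorem isReduced_flat_append {s : List Syllable} {e e' : Bool} (h : Path e s e') :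
    FreeGroup.IsReduced (flat s ++ [(0, e')]) := by
  induction s generalizing e with
  | nil => simp [flat]
  | cons g s ih =>
    have h1 := ih h.2.2
    have h2 := head?_flat_append h.2.2
    obtain ⟨ε, k, ε'⟩ := g
    obtain ⟨-, hk, -⟩ := h
    rw [flat_cons, List.cons_append, List.append_assoc]
    generalize flat s ++ [(0, e')] = T at h1 h2
    simp only at hk h2 ⊢
    rw [FreeGroup.IsReduced, List.isChain_cons, List.isChain_append]
    refine ⟨fun a ha h3 => ?_, ?_, h1, fun a ha b hb h3 => ?_⟩
    · by_cases hk0 : k = 0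
      · subst hk0
        simp only [powWord, Int.natAbs_zero, List.replicate_zero, List.nil_append, h2,
          Option.mem_some_iff] at ha
        subst ha
        by_contra hne
        exact hk hne rfl
      · obtain ⟨n, hn⟩ := Nat.exists_eq_succ_of_ne_zero (Int.natAbs_ne_zero.2 hk0)
        rw [powWord, hn, List.replicate_succ] at ha
        simp at ha
        subst ha
        simp at h3
    · exact List.isChain_replicate_of_rel _ fun _ => rfl
    · rw [h2, Option.mem_some_iff] at hb
      subst hb
      have := List.eq_of_mem_replicate (List.mem_of_mem_getLast? ha)
      subst this
      simp at h3

theorem isCyclicallyReduced_flat {s : List Syllable} {e : Bool} (h : Path e s e) :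
    FreeGroup.IsCyclicallyReduced (flat s) := by
  have h1 := isReduced_flat_append h
  have h2 := head?_flat_append h
  rw [FreeGroup.isCyclicallyReduced_iff]
  refine ⟨h1.infix ⟨[], [(0, e)], by simp⟩, fun a ha b hb => ?_⟩
  rw [FreeGroup.IsReduced, List.isChain_append] at h1
  have hne : flat s ≠ [] := by rintro h; rw [h] at hb; simp at hb
  rw [List.head?_append_of_ne_nil _ hne] at h2
  rw [h2, Option.mem_some_iff] at hb
  exact h1.2.2 a ha b (by simp [hb])

/-- Every reduced word splits into a power of `x₂` followed by syllables. -/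
theorem exists_syllables (e' : Bool) (M : List (Letter 2))
    (h : FreeGroup.IsReduced (M ++ [(0, e')])) :
    ∃ (k : ℤ) (e : Bool) (s : List Syllable), Path e s e' ∧ M = powWord k ++ flat s := by
  induction M with
  | nil => exact ⟨0, e', [], rfl, rfl⟩
  | cons a M ih =>
    obtain ⟨k, e, s, hs, rfl⟩ := ih (h.infix ⟨[a], [], by simp⟩)
    have hhead := head?_flat_append hs
    rw [List.cons_append, FreeGroup.IsReduced, List.isChain_cons] at h
    obtain ⟨i, b⟩ := a
    by_cases hi : i = 0
    · subst hi
      refine ⟨0, b, (b, k, e) :: s, ⟨rfl, fun hne hk => hne ?_, hs⟩, rfl⟩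
      simp only at hne hk ⊢
      subst hk
      exact h.1 (0, e) (by simpa [powWord] using hhead) rfl
    · obtain rfl : i = 1 := by omega
      by_cases hk : k = 0
      · subst hk
        refine ⟨cond b 1 (-1), e, s, hs, ?_⟩
        cases b <;> rfl
      · obtain ⟨n, hn⟩ := Nat.exists_eq_succ_of_ne_zero (Int.natAbs_ne_zero.2 hk)
        have hb : b = decide (0 ≤ k) := h.1 (1, decide (0 ≤ k)) (by
          rw [powWord, hn, List.replicate_succ]; simp) rfl
        refine ⟨k + cond b 1 (-1), e, s, hs, ?_⟩
        rw [← List.cons_append]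
        congr 1
        rw [powWord, powWord]
        by_cases h0 : 0 ≤ k
        · have h1 : decide (0 ≤ k) = true := by simpa using h0
          rw [h1] at hb
          subst hb
          have h2 : decide (0 ≤ k + cond true 1 (-1)) = true := by simp; omega
          have h3 : (k + cond true 1 (-1)).natAbs = k.natAbs + 1 := by simp; omega
          rw [h1, h2, h3, List.replicate_succ]
        · have h1 : decide (0 ≤ k) = false := by simpa using h0
          rw [h1] at hb
          subst hb
          have h2 : decide (0 ≤ k + cond false 1 (-1)) = false := by simp; omega
          have h3 : (k + cond false 1 (-1)).natAbs = k.natAbs + 1 := by simp; omega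
          rw [h1, h2, h3, List.replicate_succ]

/-- A cyclic word that contains `x₁` or its inverse is a cyclic sequence of syllables. -/
theorem exists_eq_ofElement_flat {w : CyclicWord 2} (h : 0 < w.occ 0) :
    ∃ (e : Bool) (s : List Syllable), Path e s e ∧ w = ofElement (FreeGroup.mk (flat s)) := by
  obtain ⟨L, hL, rfl⟩ := exists_eq_ofElement_mk w
  rw [occ_ofElement_mk hL, List.countP_pos_iff] at h
  obtain ⟨⟨i, e⟩, ha, hi⟩ := h
  obtain rfl : i = 0 := by simpa using hi
  obtain ⟨A, B, rfl⟩ := List.append_of_mem ha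
  have hrot : (A ++ (0, e) :: B) ~r ((0, e) :: B ++ A) := List.isRotated_append
  have hL' : FreeGroup.IsCyclicallyReduced ((0, e) :: B ++ A) := by
    rw [← chain_coe_iff] at hL ⊢
    rwa [← Cycle.coe_eq_coe.2 hrot]
  have hred : FreeGroup.IsReduced (((0, e) :: B ++ A) ++ [(0, e)]) := by
    rw [FreeGroup.IsReduced, List.isChain_append]
    refine ⟨hL'.1, List.isChain_singleton _, fun a ha b hb => hL'.2 a ha b ?_⟩
    simpa using hb
  obtain ⟨k, e', s, hs, heq⟩ := exists_syllables e _ hred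
  have hk : k = 0 := by
    by_contra hk
    obtain ⟨n, hn⟩ := Nat.exists_eq_succ_of_ne_zero (Int.natAbs_ne_zero.2 hk)
    rw [powWord, hn, List.replicate_succ] at heq
    simp at heq
  subst hk
  have heq' : (0, e) :: B ++ A = flat s := heq
  have he : e = e' := by
    have := head?_flat_append hs
    rw [← heq'] at this
    simpa using this
  subst he
  refine ⟨e, s, hs, ?_⟩
  rw [← heq']
  exact ofElement_eq_of_isConj (isConj_mk_of_isRotated hrot)

theorem occ_zero_flat {s : List Syllable} {e : Bool} (h : Path e s e) :
    (ofElement (FreeGroup.mk (flat s))).occ 0 = s.length := by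
  rw [occ_ofElement_mk (isCyclicallyReduced_flat h)]
  clear h
  induction s with
  | nil => rfl
  | cons g s ih =>
    rw [flat_cons, List.countP_cons, List.countP_append, ih]
    simp [powWord, List.countP_replicate]

theorem occ_one_flat {s : List Syllable} {e : Bool} (h : Path e s e) :
    (ofElement (FreeGroup.mk (flat s))).occ 1 = (s.map fun g => g.2.1.natAbs).sum := by
  rw [occ_ofElement_mk (isCyclicallyReduced_flat h)]
  clear h
  induction s with
  | nil => rfl
  | cons g s ih =>
    rw [flat_cons, List.countP_cons, List.countP_append, ih]
    simp [powWord, List.countP_replicate]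

/-- On words, the transvection acts by shifting the syllables, up to factors `x₂^{±t}` at the two
ends that telescope in a cyclic word. -/
theorem transvection_mk_flat (t : ℤ) {s : List Syllable} {e e' : Bool} (h : Path e s e') :
    transvection t (FreeGroup.mk (flat s)) =
      cond e 1 (FreeGroup.of 1 ^ (-t)) * FreeGroup.mk (flat (s.map (shift t))) *
        (cond e' 1 (FreeGroup.of 1 ^ (-t)))⁻¹ := by
  induction s generalizing e with
  | nil =>
    obtain rfl : e = e' := h
    have h1 : FreeGroup.mk (flat []) = 1 := rfl
    rw [List.map_nil, h1, _root_.map_one, mul_one, mul_inv_cancel]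
  | cons g s ih =>
    have hcons : ∀ (g : Syllable) (s : List Syllable), FreeGroup.mk (flat (g :: s)) =
        cond g.1 (FreeGroup.of 0) (FreeGroup.of 0)⁻¹ * FreeGroup.of 1 ^ g.2.1 *
          FreeGroup.mk (flat s) := by
      intro g s
      rw [flat_cons, ← mk_powWord, mul_assoc, FreeGroup.mul_mk, ← List.singleton_append,
        ← FreeGroup.mul_mk]
      congr 1
      cases g.1 <;> rfl
    rw [List.map_cons, hcons, hcons, _root_.map_mul, ih h.2.2, _root_.map_mul, map_zpow,
      transvection_of_one]
    obtain ⟨ε, k, ε'⟩ := g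
    obtain ⟨rfl, -, -⟩ := h
    simp only [shift, Syllable.slope]
    cases ε <;> cases ε' <;> simp <;> group

theorem act_transvection_flat (t : ℤ) {s : List Syllable} {e : Bool} (h : Path e s e) :
    act (transvection t) (ofElement (FreeGroup.mk (flat s))) =
      ofElement (FreeGroup.mk (flat (s.map (shift t)))) := by
  rw [act_ofElement, transvection_mk_flat t h, ofElement_conj]

/-- A cyclic word without `x₁` is a power of `x₂`. -/
theorem act_transvection_of_occ_eq_zero (t : ℤ) {w : CyclicWord 2} (h : w.occ 0 = 0) :
    act (transvection t) w = w := by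
  obtain ⟨L, hL, rfl⟩ := exists_eq_ofElement_mk w
  rw [occ_ofElement_mk hL, List.countP_eq_zero] at h
  rw [act_ofElement]
  congr 1
  clear hL
  induction L with
  | nil => exact _root_.map_one _
  | cons a L ih =>
    rw [← List.singleton_append, ← FreeGroup.mul_mk, _root_.map_mul,
      ih fun b hb => h b (List.mem_cons_of_mem _ hb)]
    congr 1
    obtain ⟨i, e⟩ := a
    have hi : i ≠ 0 := by simpa using h (i, e) (by simp)
    obtain rfl : i = 1 := by omega
    cases e
    · change transvection t (FreeGroup.of 1)⁻¹ = (FreeGroup.of 1)⁻¹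
      rw [_root_.map_inv, transvection_of_one]
    · exact transvection_of_one t

end syllables

end CyclicWord

/-! ### Convexity of the length and peak reduction -/

namespace CyclicWord

section signedPermutations

/-- The number of letters of a cyclic word that satisfy `P`. -/
def count (P : Letter 2 → Prop) [DecidablePred P] (w : CyclicWord 2) : ℕ :=
  w.1.toMultiset.countP P

theorem count_ofElement_mk {L : List (Letter 2)} (h : FreeGroup.IsCyclicallyReduced L)
    (P : Letter 2 → Prop) [DecidablePred P] :
    (ofElement (FreeGroup.mk L)).count P = L.countP P := by
  rw [count, ofElement_mk_val_of_isCyclicallyReduced h, Cycle.coe_toMultiset, Multiset.coe_countP]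

/-- An automorphism that permutes the letters does not cause any cancellation. -/
theorem count_act {φ : MulAut (FreeGroup (Fin 2))} {π : Letter 2 → Letter 2}
    (hφ : ∀ a, φ (FreeGroup.mk [a]) = FreeGroup.mk [π a])
    (hπ : ∀ a b, ((π a).1 = (π b).1 → (π a).2 = (π b).2) ↔ (a.1 = b.1 → a.2 = b.2))
    (P : Letter 2 → Prop) [DecidablePred P] (w : CyclicWord 2) :
    (act φ w).count P = w.count fun a => P (π a) := by
  obtain ⟨L, hL, rfl⟩ := exists_eq_ofElement_mk w
  have h1 : φ (FreeGroup.mk L) = FreeGroup.mk (L.map π) := by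
    clear hL
    induction L with
    | nil => exact _root_.map_one _
    | cons a L ih =>
      rw [← List.singleton_append, ← FreeGroup.mul_mk, _root_.map_mul, ih, hφ, List.map_append,
        ← FreeGroup.mul_mk]
      rfl
  have h2 : FreeGroup.IsCyclicallyReduced (L.map π) := by
    rw [← chain_coe_iff] at hL ⊢
    rw [← Cycle.map_coe, Cycle.chain_map]
    exact hL.imp fun a b => (hπ a b).2
  rw [act_ofElement, h1, count_ofElement_mk h2, count_ofElement_mk hL, List.countP_map]
  rfl

theorem count_act_swap (P : Letter 2 → Prop) [DecidablePred P] (w : CyclicWord 2) :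
    (act swap w).count P = w.count fun a => P (Equiv.swap 0 1 a.1, a.2) := by
  refine count_act (π := fun a => (Equiv.swap 0 1 a.1, a.2)) (fun a => ?_) (fun a b => ?_) P w
  · obtain ⟨i, e⟩ := a
    cases e
    · change swap (FreeGroup.of i)⁻¹ = (FreeGroup.of _)⁻¹
      rw [_root_.map_inv]
      simp [swap]
    · change swap (FreeGroup.of i) = FreeGroup.of _
      simp [swap]
  · simp

theorem count_act_flip (P : Letter 2 → Prop) [DecidablePred P] (w : CyclicWord 2) :
    (act flip w).count P = w.count fun a => P (a.1, if a.1 = 1 then !a.2 else a.2) := by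
  refine count_act (π := fun a => (a.1, if a.1 = 1 then !a.2 else a.2)) (fun a => ?_)
    (fun a b => ?_) P w
  · obtain ⟨i, e⟩ := a
    have h : ∀ i : Fin 2, flip (FreeGroup.of i) =
        FreeGroup.mk [(i, if i = 1 then false else true)] := by
      intro i
      fin_cases i
      · exact flip_of_zero
      · exact flip_of_one
    cases e
    · change flip (FreeGroup.of i)⁻¹ = _
      rw [_root_.map_inv, h, FreeGroup.inv_mk]
      fin_cases i <;> rfl
    · exact (h i).trans (by fin_cases i <;> rfl)
  · obtain ⟨i, e⟩ := a
    obtain ⟨j, f⟩ := b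
    fin_cases i <;> fin_cases j <;> cases e <;> cases f <;> simp

theorem count_congr (w : CyclicWord 2) {P Q : Letter 2 → Prop} [DecidablePred P] [DecidablePred Q]
    (h : ∀ a, P a ↔ Q a) : w.count P = w.count Q := by
  obtain rfl : P = Q := funext fun a => propext (h a)
  unfold count
  congr!

theorem occ_eq_count (w : CyclicWord 2) (i : Fin 2) : w.occ i = w.count fun a => a.1 = i := rfl

@[simp] theorem occ_zero_act_swap (w : CyclicWord 2) : (act swap w).occ 0 = w.occ 1 := by
  rw [occ_eq_count, count_act_swap]
  exact w.count_congr fun a => by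
    obtain ⟨i, e⟩ := a
    fin_cases i <;> simp

@[simp] theorem occ_one_act_swap (w : CyclicWord 2) : (act swap w).occ 1 = w.occ 0 := by
  rw [occ_eq_count, count_act_swap]
  exact w.count_congr fun a => by
    obtain ⟨i, e⟩ := a
    fin_cases i <;> simp

@[simp] theorem occ_act_flip (w : CyclicWord 2) (i : Fin 2) : (act flip w).occ i = w.occ i := by
  rw [occ_eq_count, count_act_flip]
  rfl

theorem length_act_of_mem_closure {σ : Equiv.Perm (CyclicWord 2)}
    (h : σ ∈ Subgroup.closure {act swap, act flip}) (w : CyclicWord 2) :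
    (σ w).length = w.length := by
  have hgen : ∀ x ∈ ({act swap, act flip} : Set (Equiv.Perm (CyclicWord 2))),
      ∀ w : CyclicWord 2, (x w).length = w.length := by
    rintro x (rfl | rfl) w
    · simp [length_eq_occ_add_occ, add_comm]
    · simp [length_eq_occ_add_occ]
  induction h using Subgroup.closure_induction_left generalizing w with
  | one => rfl
  | mul_left x hx y _ ih => rw [Equiv.Perm.mul_apply, hgen x hx, ih]
  | inv_mul_cancel x hx y _ ih =>
    rw [Equiv.Perm.mul_apply, ← hgen x hx, ← Equiv.Perm.mul_apply, mul_inv_cancel,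
      Equiv.Perm.one_apply, ih]

theorem act_swap_act_swap (w : CyclicWord 2) : act swap (act swap w) = w := by
  rw [← Equiv.Perm.mul_apply, act_swap_mul_self, Equiv.Perm.one_apply]

theorem act_flip_act_flip (w : CyclicWord 2) : act flip (act flip w) = w := by
  rw [← Equiv.Perm.mul_apply, act_flip_mul_self, Equiv.Perm.one_apply]

theorem act_transvection_act_transvection (s t : ℤ) (w : CyclicWord 2) :
    act (transvection s) (act (transvection t) w) = act (transvection (s + t)) w := by
  rw [act_transvection_add, Equiv.Perm.mul_apply]

theorem act_transvection_act_flip (t : ℤ) (w : CyclicWord 2) :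
    act (transvection t) (act flip w) = act flip (act (transvection (-t)) w) := by
  rw [act_transvection_neg, ← act_flip_conj_transvection]
  simp only [Equiv.Perm.mul_apply, act_flip_act_flip]

end signedPermutations

section convexity

@[simp] theorem occ_zero_act_transvection (t : ℤ) (w : CyclicWord 2) :
    (act (transvection t) w).occ 0 = w.occ 0 := by
  rcases Nat.eq_zero_or_pos (w.occ 0) with h | h
  · rw [act_transvection_of_occ_eq_zero t h]
  · obtain ⟨e, s, hs, rfl⟩ := exists_eq_ofElement_flat h
    rw [act_transvection_flat t hs, occ_zero_flat hs, occ_zero_flat (hs.map_shift t),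
      List.length_map]

/-- The number of letters `x₂^{±1}` is a convex function along the powers of a transvection. -/
theorem two_mul_occ_one_act_transvection_le (w : CyclicWord 2) :
    2 * (act (transvection 1) w).occ 1 ≤
      (act (transvection 1) (act (transvection 1) w)).occ 1 + w.occ 1 := by
  rcases Nat.eq_zero_or_pos (w.occ 0) with h | h
  · rw [act_transvection_of_occ_eq_zero 1 h, act_transvection_of_occ_eq_zero 1 h]
    omega
  · obtain ⟨e, s, hs, rfl⟩ := exists_eq_ofElement_flat h
    rw [act_transvection_act_transvection, act_transvection_flat 1 hs, act_transvection_flat _ hs,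
      occ_one_flat hs, occ_one_flat (hs.map_shift 1), occ_one_flat (hs.map_shift _), List.map_map,
      List.map_map]
    clear hs h
    induction s with
    | nil => simp
    | cons g s ih =>
      simp only [List.map_cons, List.sum_cons, Function.comp_apply, Syllable.shift]
      generalize g.slope = c
      omega

/-- The transvection `x₂ ↦ x₂ x₁` in terms of `x₁ ↦ x₁ x₂`. -/
theorem act_swap_conj_transvection_apply (w : CyclicWord 2) :
    (act swap * act (transvection 1) * act swap) w =
      act (transvection 1) (act flip (act swap (act (transvection 1) w))) := by
  have h : act swap * act (transvection 1) * act swap =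
      act (transvection 1) * (act flip * act swap * act (transvection 1)) := by
    rw [← act_triangle, mul_inv_cancel_left]
  rw [h]
  rfl

theorem occ_zero_swap_conj (w : CyclicWord 2) :
    ((act swap * act (transvection 1) * act swap) w).occ 0 = (act (transvection 1) w).occ 1 := by
  rw [act_swap_conj_transvection_apply]
  simp

theorem occ_one_swap_conj (w : CyclicWord 2) :
    ((act swap * act (transvection 1) * act swap) w).occ 1 = w.occ 1 := by
  simp

theorem two_mul_occ_zero_swap_conj_le (w : CyclicWord 2) :
    2 * (act (transvection 1) w).occ 1 ≤
      (act (transvection 1) ((act swap * act (transvection 1) * act swap) w)).occ 1 + w.occ 0 := by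
  rw [← occ_zero_swap_conj w, ← occ_zero_swap_conj ((act swap * act (transvection 1) * act swap) w)]
  have h := two_mul_occ_one_act_transvection_le (act swap w)
  simpa [act_swap_act_swap] using h

/-- Along a positive word in the two transvections `x₁ ↦ x₁ x₂` and `x₂ ↦ x₂ x₁`, the length does
not decrease, and it stays the same only for powers of the former. -/
theorem length_le_of_mem_closure {u : CyclicWord 2} (h01 : u.occ 0 < u.occ 1)
    (h : u.occ 1 ≤ (act (transvection 1) u).occ 1) {x : Equiv.Perm (CyclicWord 2)}
    (hx : x ∈ Submonoid.closure
      {act (transvection 1), act swap * act (transvection 1) * act swap}) :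
    u.length ≤ (x u).length ∧
      ((x u).length = u.length → ∃ t, x u = act (transvection t) u) ∧
      (x u).occ 0 ≤ (act (transvection 1) (x u)).occ 1 ∧
      (x u).occ 1 ≤ (act (transvection 1) (x u)).occ 1 := by
  induction hx using Submonoid.closure_induction_left with
  | one => exact ⟨le_rfl, fun _ => ⟨0, by rw [act_transvection_zero]⟩, (h01.trans_le h).le, h⟩
  | mul_left y hy z _ ih =>
    obtain ⟨h1, h2, h3, h4⟩ := ih
    rw [Equiv.Perm.mul_apply]
    generalize z u = v at h1 h2 h3 h4
    simp only [length_eq_occ_add_occ] at h1 h2 ⊢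
    rcases hy with rfl | rfl
    · have h5 := two_mul_occ_one_act_transvection_le v
      have h6 := occ_zero_act_transvection 1 v
      refine ⟨by omega, fun heq => ?_, by omega, by omega⟩
      obtain ⟨t, rfl⟩ := h2 (by omega)
      exact ⟨1 + t, act_transvection_act_transvection 1 t u⟩
    · have h5 := two_mul_occ_zero_swap_conj_le v
      have h6 := occ_zero_swap_conj v
      have h7 := occ_one_swap_conj v
      refine ⟨by omega, fun heq => ?_, by omega, by omega⟩
      obtain ⟨t, rfl⟩ := h2 (by omega)
      have h8 := occ_zero_act_transvection t u
      omega

/-- **Peak reduction** in rank two. -/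
theorem length_le_act {u : CyclicWord 2} (h01 : u.occ 0 < u.occ 1)
    (h : u.occ 1 ≤ (act (transvection 1) u).occ 1)
    (h' : u.occ 1 ≤ (act (transvection (-1)) u).occ 1) (φ : MulAut (FreeGroup (Fin 2))) :
    u.length ≤ (act φ u).length ∧
      ((act φ u).length = u.length → ∃ σ ∈ Subgroup.closure {act swap, act flip}, ∃ t,
        act φ u = σ (act (transvection t) u)) := by
  obtain ⟨σ, hσ, x, hx, η, hη, heq⟩ := exists_signed_mul_positive_of_mem_closure act_swap_mul_self
    act_flip_mul_self (act_flip_conj_transvection 1) (act_flip_conj_transvection' 1) act_triangle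
    (act_mem_closure φ)
  rw [heq, Equiv.Perm.mul_apply, Equiv.Perm.mul_apply, length_act_of_mem_closure hσ]
  rcases hη with rfl | rfl
  · obtain ⟨h1, h2, -⟩ := length_le_of_mem_closure h01 h hx
    refine ⟨h1, fun heq => ?_⟩
    obtain ⟨t, ht⟩ := h2 heq
    exact ⟨σ, hσ, t, by rw [Equiv.Perm.one_apply, ht]⟩
  · obtain ⟨h1, h2, -⟩ := length_le_of_mem_closure (u := act flip u) (by simpa using h01)
      (by simpa [act_transvection_act_flip] using h') hx
    have hl : (act flip u).length = u.length := by simp [length_eq_occ_add_occ]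
    rw [hl] at h1 h2
    refine ⟨h1, fun heq => ?_⟩
    obtain ⟨t, ht⟩ := h2 heq
    refine ⟨σ * act flip, mul_mem hσ (Subgroup.subset_closure (by simp)), -t, ?_⟩
    rw [ht, Equiv.Perm.mul_apply, act_transvection_act_flip]

end convexity

end CyclicWord

/-! ### The upper bound -/

namespace CyclicWord

section counting

theorem mem_orbit_iff {v w : CyclicWord 2} : v ∈ orbit w ↔ ∃ φ, v = act φ w := Iff.rfl

theorem orbit_act (φ : MulAut (FreeGroup (Fin 2))) (w : CyclicWord 2) :
    orbit (act φ w) = orbit w := by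
  ext v
  simp only [mem_orbit_iff]
  constructor
  · rintro ⟨ψ, rfl⟩
    exact ⟨ψ * φ, by rw [_root_.map_mul, Equiv.Perm.mul_apply]⟩
  · rintro ⟨ψ, rfl⟩
    exact ⟨ψ * φ⁻¹, by rw [← Equiv.Perm.mul_apply, ← _root_.map_mul, inv_mul_cancel_right]⟩

theorem length_act_swap (w : CyclicWord 2) : (act swap w).length = w.length :=
  length_act_of_mem_closure (Subgroup.subset_closure (by simp)) w

theorem length_act_flip (w : CyclicWord 2) : (act flip w).length = w.length :=
  length_act_of_mem_closure (Subgroup.subset_closure (by simp)) w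

theorem N_act_swap (w : CyclicWord 2) : (act swap w).N = w.N := by
  rw [N, N, orbit_act, length_act_swap]

/-- The eight signed permutations of the generators. -/
def signedPerm (i k j : Bool) : Equiv.Perm (CyclicWord 2) :=
  cond i (act swap) 1 * cond k (act swap * act flip * act swap) 1 * cond j (act flip) 1

theorem exists_eq_signedPerm {σ : Equiv.Perm (CyclicWord 2)}
    (h : σ ∈ Subgroup.closure {act swap, act flip}) : ∃ i k j, σ = signedPerm i k j :=
  exists_eq_of_mem_closure_pair act_swap_mul_self act_flip_mul_self act_swap_flip_comm h

theorem ncard_le_card_of_forall_exists {α β : Type*} {S : Set β} {A : Finset α} {F : α → β}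
    (h : ∀ v ∈ S, ∃ x ∈ A, F x = v) : S.ncard ≤ A.card := by
  classical
  have hsub : S ⊆ (A.image F : Finset β) := fun v hv => by
    obtain ⟨x, hx, rfl⟩ := h v hv
    exact Finset.mem_coe.2 (Finset.mem_image_of_mem F hx)
  have h1 := Set.ncard_le_ncard hsub (Finset.finite_toSet _)
  rw [Set.ncard_coe_finset] at h1
  exact h1.trans Finset.card_image_le

variable {u : CyclicWord 2}

/-- `N` is at most eight times the number of words of the same length in the orbit of `u` under
the transvections `x₁ ↦ x₁ x₂ᵗ`. -/
theorem N_le_eight_mul (h01 : u.occ 0 < u.occ 1)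
    (hmin : ∀ φ, u.length ≤ (act φ u).length) {I : Finset ℤ}
    (hI : ∀ t, (act (transvection t) u).length = u.length →
      ∃ t' ∈ I, act (transvection t) u = act (transvection t') u) : u.N ≤ 8 * I.card := by
  have h : ∀ t, u.occ 1 ≤ (act (transvection t) u).occ 1 := fun t => by
    have := hmin (transvection t)
    rw [length_eq_occ_add_occ, length_eq_occ_add_occ, occ_zero_act_transvection] at this
    omega
  let F : (Bool × Bool × Bool) × ℤ → CyclicWord 2 :=
    fun x => signedPerm x.1.1 x.1.2.1 x.1.2.2 (act (transvection x.2) u)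
  have hsub : ∀ v ∈ {v : CyclicWord 2 | v ∈ orbit u ∧ v.length = u.length},
      ∃ x ∈ (Finset.univ : Finset (Bool × Bool × Bool)) ×ˢ I, F x = v := by
    rintro v ⟨hv, hl⟩
    obtain ⟨φ, rfl⟩ := mem_orbit_iff.1 hv
    obtain ⟨σ, hσ, t, ht⟩ := (length_le_act h01 (h 1) (h (-1)) φ).2 hl
    obtain ⟨i, k, j, hs⟩ := exists_eq_signedPerm hσ
    rw [ht, length_act_of_mem_closure hσ] at hl
    obtain ⟨t', ht', heq⟩ := hI t hl
    exact ⟨((i, k, j), t'), by simp [ht'], by rw [ht, heq, hs]⟩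
  refine (ncard_le_card_of_forall_exists hsub).trans_eq ?_
  rw [Finset.card_product]
  rfl

/-- If the sign change of `x₂` permutes the words in the orbit of `u` under transvections, then the
bound on `N` improves by a factor of two. -/
theorem N_le_four_mul (h01 : u.occ 0 < u.occ 1)
    (hmin : ∀ φ, u.length ≤ (act φ u).length) {I : Finset ℤ}
    (hI : ∀ t, (act (transvection t) u).length = u.length → t ∈ I)
    (hflip : ∀ t, ∃ t', act flip (act (transvection t) u) = act (transvection t') u) :
    u.N ≤ 4 * I.card := by
  have h : ∀ t, u.occ 1 ≤ (act (transvection t) u).occ 1 := fun t => by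
    have := hmin (transvection t)
    rw [length_eq_occ_add_occ, length_eq_occ_add_occ, occ_zero_act_transvection] at this
    omega
  let F : (Bool × Bool) × ℤ → CyclicWord 2 :=
    fun x => signedPerm x.1.1 x.1.2 false (act (transvection x.2) u)
  have hsub : ∀ v ∈ {v : CyclicWord 2 | v ∈ orbit u ∧ v.length = u.length},
      ∃ x ∈ (Finset.univ : Finset (Bool × Bool)) ×ˢ I, F x = v := by
    rintro v ⟨hv, hl⟩
    obtain ⟨φ, rfl⟩ := mem_orbit_iff.1 hv
    obtain ⟨σ, hσ, t, ht⟩ := (length_le_act h01 (h 1) (h (-1)) φ).2 hl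
    obtain ⟨i, k, j, hs⟩ := exists_eq_signedPerm hσ
    rw [ht, length_act_of_mem_closure hσ] at hl
    cases j
    · exact ⟨((i, k), t), by simp [hI t hl], by rw [ht, hs]⟩
    · obtain ⟨t', ht'⟩ := hflip t
      rw [← length_act_flip, ht'] at hl
      refine ⟨((i, k), t'), by simp [hI t' hl], ?_⟩
      simp only [F]
      rw [ht, hs, ← ht']
      rfl
  refine (ncard_le_card_of_forall_exists hsub).trans_eq ?_
  rw [Finset.card_product]
  rfl

end counting

section profile

open Syllable

/-- The number of letters `x₂^{±1}` after applying `x₁ ↦ x₁ x₂ᵗ` to a sequence of syllables. -/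
def profile (s : List Syllable) (t : ℤ) : ℕ := (s.map fun g => (g.2.1 + t * g.slope).natAbs).sum

theorem occ_one_act_transvection_flat (t : ℤ) {s : List Syllable} {e : Bool} (h : Path e s e) :
    (act (transvection t) (ofElement (FreeGroup.mk (flat s)))).occ 1 = profile s t := by
  rw [act_transvection_flat t h, occ_one_flat (h.map_shift t), List.map_map]
  rfl

/-- The number of syllables whose exponent moves with the transvection. -/
def moving (s : List Syllable) : ℕ := s.countP fun g => g.slope ≠ 0

/-- The number of syllables whose exponent is fixed by the transvection. -/
def fixed (s : List Syllable) : ℕ := s.countP fun g => g.slope = 0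

theorem length_eq_moving_add_fixed (s : List Syllable) : s.length = moving s + fixed s := by
  rw [moving, fixed, List.length_eq_countP_add_countP (fun g : Syllable => decide (g.slope ≠ 0))]
  congr 1
  exact List.countP_congr fun g _ => by simp

theorem slope_cases (g : Syllable) : g.slope = 0 ∨ g.slope = 1 ∨ g.slope = -1 := by
  obtain ⟨a, k, b⟩ := g
  cases a <;> cases b <;> simp [Syllable.slope]

/-- The sign of `x₁` changes an even number of times around a cyclic word. -/
theorem fixed_mod_two {s : List Syllable} {e e' : Bool} (h : Path e s e') :
    fixed s % 2 = if e = e' then 0 else 1 := by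
  induction s generalizing e with
  | nil => simp [fixed, show e = e' from h]
  | cons g s ih =>
    have h1 := ih h.2.2
    have h2 : fixed (g :: s) = fixed s + if g.slope = 0 then 1 else 0 := by
      simp [fixed, List.countP_cons]
    obtain ⟨a, k, b⟩ := g
    obtain ⟨rfl, -, -⟩ := h
    rw [h2]
    cases a <;> cases b <;> cases e' <;> simp [Syllable.slope] at h1 ⊢ <;> omega

theorem profile_cons (g : Syllable) (s : List Syllable) (t : ℤ) :
    profile (g :: s) t = (g.2.1 + t * g.slope).natAbs + profile s t := by
  simp [profile]

theorem profile_add_profile_succ_mod_two (s : List Syllable) (t : ℤ) :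
    (profile s t + profile s (t + 1)) % 2 = moving s % 2 := by
  induction s with
  | nil => rfl
  | cons g s ih =>
    have h2 : moving (g :: s) = moving s + if g.slope ≠ 0 then 1 else 0 := by
      simp [moving, List.countP_cons]
    rw [profile_cons, profile_cons, h2]
    rcases slope_cases g with h | h | h <;> rw [h] <;> simp <;> omega

theorem two_mul_profile_succ_le (s : List Syllable) (t : ℤ) :
    2 * profile s (t + 1) ≤ profile s (t + 2) + profile s t := by
  induction s with
  | nil => rfl
  | cons g s ih =>
    simp only [profile_cons, add_mul]
    generalize g.slope = c
    generalize t * c = d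
    omega

/-- A moving syllable contributes `|k| + |k'| ≥ |k - k'| = |t - t'|`, and a fixed one has a nonzero
exponent. -/
theorem moving_mul_add_le {s : List Syllable} {e e' : Bool} (h : Path e s e') (t t' : ℤ) :
    (moving s : ℤ) * (t' - t) + 2 * fixed s ≤ profile s t + profile s t' := by
  induction s generalizing e with
  | nil => simp [moving, fixed, profile]
  | cons g s ih =>
    have h1 := ih h.2.2
    have h2 : moving (g :: s) = moving s + if g.slope ≠ 0 then 1 else 0 := by
      simp [moving, List.countP_cons]
    have h3 : fixed (g :: s) = fixed s + if g.slope = 0 then 1 else 0 := by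
      simp [fixed, List.countP_cons]
    have h4 := h.2.1
    rw [profile_cons, profile_cons, h2, h3]
    rcases slope_cases g with h | h | h
    · have h5 : g.2.1 ≠ 0 := h4 fun heq => by
        rw [Syllable.slope, if_pos heq] at h
        cases hg : g.1 <;> rw [hg] at h <;> simp at h
      simp only [h, ne_eq, not_true_eq_false, if_true, if_false, Nat.cast_add, Nat.cast_one,
        add_zero, mul_zero]
      omega
    · simp only [h, ne_eq, one_ne_zero, not_false_eq_true, if_true, if_false, Nat.cast_add,
        Nat.cast_one, add_mul, one_mul, add_zero, mul_one]
      omega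
    · simp only [h, ne_eq, neg_eq_zero, one_ne_zero, not_false_eq_true, if_true, if_false,
        Nat.cast_add, Nat.cast_one, add_mul, one_mul, add_zero, mul_neg, mul_one]
      omega

/-- Between two minima of the convex function `profile s` it is constant. -/
theorem profile_succ_eq {s : List Syllable} {t t' : ℤ} (hlt : t < t')
    (heq : profile s t' = profile s t) (hmin : profile s t ≤ profile s (t + 1)) :
    profile s (t + 1) = profile s t := by
  by_contra hne
  have key : ∀ n : ℕ, profile s t < profile s (t + 1 + n) ∧
      profile s (t + n) < profile s (t + 1 + n) := by
    intro n
    induction n with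
    | zero => simp only [Nat.cast_zero, add_zero]; omega
    | succ n ih =>
      have := two_mul_profile_succ_le s (t + n)
      have e1 : t + (n : ℤ) + 1 = t + 1 + n := by ring
      have e2 : t + (n : ℤ) + 2 = t + 1 + (n + 1 : ℕ) := by push_cast; ring
      have e3 : t + ((n + 1 : ℕ) : ℤ) = t + 1 + n := by push_cast; ring
      rw [e1, e2] at this
      rw [e3]
      omega
  have := (key (t' - t - 1).toNat).1
  rw [show t + 1 + ((t' - t - 1).toNat : ℤ) = t' by omega] at this
  omega

end profile

section upperBound

open Syllable

/-- A cyclic word `x₁^ε x₂ᵃ x₁^ε x₂ᵇ` becomes a translate of itself if the sign of `x₂` is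
changed. -/
theorem act_flip_flat_pair (e : Bool) (a b : ℤ) :
    act flip (ofElement (FreeGroup.mk (flat [(e, a, e), (e, b, e)]))) =
      ofElement (FreeGroup.mk (flat [(e, -b, e), (e, -a, e)])) := by
  have h : ∀ a b : ℤ, FreeGroup.mk (flat [(e, a, e), (e, b, e)]) =
      FreeGroup.mk [(0, e)] * FreeGroup.of 1 ^ a *
        (FreeGroup.mk [(0, e)] * FreeGroup.of 1 ^ b) := by
    intro a b
    rw [← mk_powWord, ← mk_powWord, FreeGroup.mul_mk, FreeGroup.mul_mk, FreeGroup.mul_mk]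
    simp [flat, word]
  have h0 : flip (FreeGroup.mk [(0, e)]) = FreeGroup.mk [(0, e)] := by
    cases e
    · change flip (FreeGroup.of 0)⁻¹ = (FreeGroup.of 0)⁻¹
      rw [_root_.map_inv, flip_of_zero]
    · exact flip_of_zero
  rw [act_ofElement, h, h, _root_.map_mul, _root_.map_mul, _root_.map_mul, h0, map_zpow, map_zpow,
    flip_of_one, inv_zpow', inv_zpow',
    ← ofElement_conj (FreeGroup.mk [(0, e)] * FreeGroup.of 1 ^ (-a))⁻¹]
  congr 1
  group

/-- The upper bound, under the assumption that `x₂` occurs more often than `x₁`. -/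
theorem N_le_of_occ_lt {u : CyclicWord 2} (h01 : u.occ 0 < u.occ 1)
    (hmin : ∀ φ, u.length ≤ (act φ u).length) (h9 : 9 ≤ u.length) :
    u.N + 40 ≤ 8 * u.length := by
  -- if all transvections fix `u` there are at most eight words
  have hfix : (∀ t, act (transvection t) u = u) → u.N + 40 ≤ 8 * u.length := by
    intro hfix
    have := N_le_eight_mul h01 hmin (I := {0}) fun t _ => ⟨0, by simp, by rw [hfix, hfix]⟩
    rw [Finset.card_singleton] at this
    omega
  rcases Nat.eq_zero_or_pos (u.occ 0) with h0 | h0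
  · exact hfix fun t => act_transvection_of_occ_eq_zero t h0
  obtain ⟨e, s, hs, hu⟩ := exists_eq_ofElement_flat h0
  have hocc0 : u.occ 0 = moving s + fixed s := by
    rw [hu, occ_zero_flat hs, length_eq_moving_add_fixed]
  have hocc1 : ∀ t, (act (transvection t) u).occ 1 = profile s t := fun t => by
    rw [hu, occ_one_act_transvection_flat t hs]
  have hocc1' : u.occ 1 = profile s 0 := by
    rw [← hocc1, act_transvection_zero, Equiv.Perm.one_apply]
  have hlen : u.length = moving s + fixed s + profile s 0 := by
    rw [length_eq_occ_add_occ, hocc0, hocc1']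
  have hlent : ∀ t, (act (transvection t) u).length =
      moving s + fixed s + profile s t := fun t => by
    rw [length_eq_occ_add_occ, occ_zero_act_transvection, hocc0, hocc1]
  have hmin' : ∀ t, profile s 0 ≤ profile s t := fun t => by
    have := hmin (transvection t)
    rw [hlent, hlen] at this
    omega
  have hfixed : fixed s % 2 = 0 := by simpa using fixed_mod_two hs
  rcases Nat.eq_zero_or_pos (moving s) with hm0 | hm0
  · refine hfix fun t => ?_
    rw [hu, act_transvection_flat t hs]
    congr 3
    rw [List.map_congr_left (g := id), List.map_id]
    intro g hg
    have : g.slope = 0 := by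
      have := List.countP_eq_zero.1 hm0 g hg
      simpa using this
    simp [shift, this]
  -- the exponents `t` for which the length does not change lie in an interval
  have hbound : ∀ t t', profile s t = profile s 0 → profile s t' = profile s 0 →
      (moving s : ℤ) * (t' - t) + 2 * fixed s ≤ 2 * profile s 0 := fun t t' ht ht' => by
    have := moving_mul_add_le hs t t'
    rw [ht, ht'] at this
    omega
  have habs : ∀ t, profile s t = profile s 0 → t ∈ Finset.Icc (-2 * (profile s 0 : ℤ))
      (2 * (profile s 0 : ℤ)) := by
    intro t ht
    have h1 := hbound 0 t rfl ht
    have h2 := hbound t 0 ht rfl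
    rw [Finset.mem_Icc]
    constructor <;> nlinarith
  classical
  set J := (Finset.Icc (-2 * (profile s 0 : ℤ)) (2 * (profile s 0 : ℤ))).filter
    fun t => profile s t = profile s 0 with hJ
  have hmemJ : ∀ t, (act (transvection t) u).length = u.length → t ∈ J := fun t ht => by
    rw [hlent, hlen] at ht
    have ht' : profile s t = profile s 0 := by omega
    exact Finset.mem_filter.2 ⟨habs t ht', ht'⟩
  have hJne : J.Nonempty := ⟨0, Finset.mem_filter.2 ⟨habs 0 rfl, rfl⟩⟩
  have ht₀ := (Finset.mem_filter.1 (J.min'_mem hJne)).2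
  have ht₁ := (Finset.mem_filter.1 (J.max'_mem hJne)).2
  have hle := J.min'_le_max' hJne
  have hcard : (J.card : ℤ) ≤ J.max' hJne - J.min' hJne + 1 := by
    have : J ⊆ Finset.Icc (J.min' hJne) (J.max' hJne) := fun t ht =>
      Finset.mem_Icc.2 ⟨J.min'_le t ht, J.le_max' t ht⟩
    have := Finset.card_le_card this
    rw [Int.card_Icc] at this
    omega
  generalize J.min' hJne = t₀ at *
  generalize J.max' hJne = t₁ at *
  have hN8 := N_le_eight_mul h01 hmin (I := J) fun t ht => ⟨t, hmemJ t ht, rfl⟩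
  have hb := hbound t₀ t₁ ht₀ ht₁
  rcases hle.eq_or_lt with heq | hlt
  · omega
  have hmoving : moving s % 2 = 0 := by
    have h1 := profile_succ_eq hlt (ht₁.trans ht₀.symm) (ht₀ ▸ hmin' _)
    have h2 := profile_add_profile_succ_mod_two s t₀
    omega
  rcases (show 4 ≤ moving s ∨ moving s = 2 by omega) with hm | hm
  · have : 4 * (t₁ - t₀) ≤ moving s * (t₁ - t₀) :=
      mul_le_mul_of_nonneg_right (by exact_mod_cast hm) (by omega)
    omega
  rw [hm] at hb
  rcases Nat.eq_zero_or_pos (fixed s) with hf | hf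
  · -- here `u` is `x₁^ε x₂ᵃ x₁^ε x₂ᵇ`
    have hN4 := N_le_four_mul h01 hmin hmemJ fun t => by
      have hl : s.length = 2 := by rw [length_eq_moving_add_fixed, hm, hf]
      obtain ⟨⟨e₁, a, e₂⟩, ⟨e₃, b, e₄⟩, rfl⟩ := List.length_eq_two.1 hl
      have h1 : (Syllable.slope (e₁, a, e₂)) ≠ 0 := by
        have := List.countP_eq_zero.1 hf (e₁, a, e₂) (by simp)
        simpa using this
      obtain rfl : e₁ = e₂ := by
        by_contra hne
        simp [Syllable.slope, hne] at h1
      simp only [Syllable.Path] at hs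
      obtain ⟨rfl, -, rfl, -, rfl⟩ := hs
      have hp : Syllable.Path e₄ [(e₄, a, e₄), (e₄, b, e₄)] e₄ :=
        ⟨rfl, fun h => absurd rfl h, rfl, fun h => absurd rfl h, rfl⟩
      refine ⟨-(cond e₄ 1 (-1) * (a + b)) - t, ?_⟩
      rw [hu, act_transvection_flat _ hp,
        act_transvection_flat _ hp]
      simp only [List.map_cons, List.map_nil, shift, Syllable.slope, if_true]
      rw [act_flip_flat_pair]
      cases e₄ <;> simp only [cond_true, cond_false] <;> ring_nf
    omega
  · omega

theorem N_le {u : CyclicWord 2} (hu : u.Hyp) (h9 : 9 ≤ u.length) :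
    u.N + 40 ≤ 8 * u.length := by
  have hmin : ∀ φ, u.length ≤ (act φ u).length := fun φ => hu.1 _ ⟨φ, rfl⟩
  have hl := length_eq_occ_add_occ u
  rcases Nat.eq_zero_or_pos (u.occ 1) with h1 | h1
  · have := N_le_of_occ_lt (u := act swap u) (by simp; omega) (fun φ => by
      rw [length_act_swap, ← Equiv.Perm.mul_apply, ← _root_.map_mul]
      exact hmin _) (by rwa [length_act_swap])
    rwa [N_act_swap, length_act_swap] at this
  · refine N_le_of_occ_lt ?_ hmin h9
    rcases Nat.eq_zero_or_pos (u.occ 0) with h0 | h0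
    · omega
    · exact hu.2 0 1 (by decide) h0 h1

end upperBound

end CyclicWord

/-! ### The extremal words -/

namespace CyclicWord

section extremal

open Syllable

/-- The syllables of the images of `extremal ℓ` under `x₁ ↦ x₁ x₂⁻ˢ`. -/
def extremalSyllables (ℓ : ℕ) (s : ℤ) : List Syllable :=
  [(true, -s, true), (true, 1, false), (false, 1, true), (true, ℓ - s, true)]

theorem path_extremalSyllables (ℓ : ℕ) (s : ℤ) :
    Syllable.Path true (extremalSyllables ℓ s) true := by
  simp [extremalSyllables, Syllable.Path]

theorem extremal_eq (ℓ : ℕ) :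
    extremal ℓ = ofElement (FreeGroup.mk (flat (extremalSyllables ℓ 0))) := by
  have h : flat (extremalSyllables ℓ 0) =
      [(0, true), (0, true), (1, true), (0, false), (1, true), (0, true)] ++ powWord ℓ := by
    simp [flat, word, extremalSyllables, powWord]
  rw [extremal, h, ← FreeGroup.mul_mk, mk_powWord, zpow_natCast]
  congr 1

theorem act_transvection_extremal (ℓ : ℕ) (s : ℤ) :
    act (transvection (-s)) (extremal ℓ) =
      ofElement (FreeGroup.mk (flat (extremalSyllables ℓ s))) := by
  rw [extremal_eq, act_transvection_flat _ (path_extremalSyllables ℓ 0)]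
  simp [extremalSyllables, shift, Syllable.slope, sub_eq_add_neg]

theorem occ_zero_extremal (ℓ : ℕ) : (extremal ℓ).occ 0 = 4 := by
  rw [extremal_eq, occ_zero_flat (path_extremalSyllables ℓ 0)]
  rfl

theorem occ_one_act_transvection_extremal (ℓ : ℕ) (t : ℤ) :
    (act (transvection t) (extremal ℓ)).occ 1 = t.natAbs + 2 + (ℓ + t).natAbs := by
  rw [← neg_neg t, act_transvection_extremal, occ_one_flat (path_extremalSyllables ℓ _)]
  simp [extremalSyllables]
  omega

theorem occ_one_extremal (ℓ : ℕ) : (extremal ℓ).occ 1 = ℓ + 2 := by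
  have := occ_one_act_transvection_extremal ℓ 0
  rw [act_transvection_zero, Equiv.Perm.one_apply] at this
  omega

theorem length_extremal (ℓ : ℕ) : (extremal ℓ).length = ℓ + 6 := by
  rw [length_eq_occ_add_occ, occ_zero_extremal, occ_one_extremal]
  omega

theorem hyp_extremal {ℓ : ℕ} (hℓ : 3 ≤ ℓ) : (extremal ℓ).Hyp := by
  have h0 := occ_zero_extremal ℓ
  have h1 := occ_one_extremal ℓ
  constructor
  · rintro _ ⟨φ, rfl⟩
    refine (length_le_act (by omega) ?_ ?_ φ).1
    · rw [occ_one_act_transvection_extremal]; omega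
    · rw [occ_one_act_transvection_extremal]; omega
  · intro i j hij _ _
    obtain rfl : i = 0 := by omega
    obtain rfl : j = 1 := by omega
    omega

/-- Two of the eight signed permutations of words `x₁ x₂⁻ˢ x₁ x₂ x₁⁻¹ x₂ x₁ x₂^(ℓ-s)` with
`0 ≤ s ≤ ℓ` are never equal. -/
theorem signedPerm_extremal_injective {ℓ : ℕ} (hℓ : 3 ≤ ℓ) {i k j i' k' j' : Bool} {s s' : ℕ}
    (hs : s ≤ ℓ) (hs' : s' ≤ ℓ)
    (h : signedPerm i k j (act (transvection (-s)) (extremal ℓ)) =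
      signedPerm i' k' j' (act (transvection (-s')) (extremal ℓ))) :
    i = i' ∧ k = k' ∧ j = j' ∧ s = s' := by
  have happly : ∀ (i k j : Bool) (w : CyclicWord 2), signedPerm i k j w =
      cond i (act swap) 1 (cond k (act swap * act flip * act swap) 1 (cond j (act flip) 1 w)) :=
    fun _ _ _ _ => rfl
  have hocc0 : ∀ s : ℤ, (act (transvection s) (extremal ℓ)).occ 0 = 4 := fun s => by
    rw [occ_zero_act_transvection, occ_zero_extremal]
  have hocc1 : ∀ s : ℕ, s ≤ ℓ → (act (transvection (-s)) (extremal ℓ)).occ 1 = ℓ + 2 :=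
    fun s hs => by rw [occ_one_act_transvection_extremal]; omega
  have hcount : ∀ s : ℕ, s ≤ ℓ → ∀ P : Letter 2 → Prop, ∀ _ : DecidablePred P,
      (act (transvection (-s)) (extremal ℓ)).count P =
        3 * (if P (0, true) then 1 else 0) + (if P (0, false) then 1 else 0) +
        (ℓ + 2 - s) * (if P (1, true) then 1 else 0) + s * (if P (1, false) then 1 else 0) := by
    intro s hs P _
    have h1 : powWord (-(s : ℤ)) = List.replicate s (1, false) := by
      rcases s.eq_zero_or_pos with rfl | h
      · rfl
      · have : ¬ (0 : ℤ) ≤ -(s : ℤ) := by omega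
        simp [powWord, h.ne']
    have h2 : powWord ((ℓ : ℤ) - s) = List.replicate (ℓ - s) (1, true) := by
      have e : ((ℓ : ℤ) - s) = ((ℓ - s : ℕ) : ℤ) := by omega
      simp [powWord, e]
    have h3 : powWord 1 = [(1, true)] := rfl
    have h4 : ℓ + 2 - s = ℓ - s + 2 := by omega
    rw [act_transvection_extremal,
      count_ofElement_mk (isCyclicallyReduced_flat (path_extremalSyllables ℓ s))]
    simp only [extremalSyllables, flat, word, List.flatMap_cons, List.flatMap_nil, h1, h2, h3, h4,
      List.cons_append, List.nil_append, List.append_nil, List.countP_cons, List.countP_append,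
      List.countP_replicate, decide_eq_true_eq, mul_ite, mul_one, mul_zero]
    split_ifs <;> omega
  rw [happly, happly] at h
  -- the numbers of occurrences of the two generators distinguish the swap
  have hi : i = i' := by
    have := congrArg (fun w => occ w 0) h
    cases i <;> cases i' <;> cases k <;> cases k' <;> cases j <;> cases j' <;>
      simp [hocc0, hocc1 s hs, hocc1 s' hs'] at this ⊢ <;> omega
  subst hi
  have h := (cond i (act swap) 1).injective h
  -- the letter `x₁` occurs three times, its inverse once
  have hk : k = k' := by
    have := congrArg (fun w => count (fun a => a = (0, true)) w) h
    cases k <;> cases k' <;> cases j <;> cases j' <;>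
      simp [count_act_swap, count_act_flip, hcount s hs, hcount s' hs'] at this ⊢
  subst hk
  have h := (cond k (act swap * act flip * act swap) 1).injective h
  -- a sign change of `x₂` is excluded by the letters, and by the effect of a transvection
  have hne : ∀ s s' : ℕ, s ≤ ℓ → s' ≤ ℓ → act flip (act (transvection (-s)) (extremal ℓ)) ≠
      act (transvection (-s')) (extremal ℓ) := by
    intro s s' hs hs' heq
    have h1 := congrArg (fun w => count (fun a => a = (1, true)) w) heq
    simp [count_act_flip, hcount s hs, hcount s' hs'] at h1
    have h2 := congrArg (fun w => occ (act (transvection s') w) 1) heq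
    simp only [act_transvection_act_flip, act_transvection_act_transvection, occ_act_flip,
      occ_one_act_transvection_extremal] at h2
    omega
  cases j <;> cases j'
  · refine ⟨rfl, rfl, rfl, ?_⟩
    have := congrArg (fun w => count (fun a => a = (1, false)) w) h
    simpa [hcount s hs, hcount s' hs'] using this
  · exact absurd h.symm (hne _ _ hs' hs)
  · exact absurd h (hne _ _ hs hs')
  · refine ⟨rfl, rfl, rfl, ?_⟩
    have := congrArg (fun w => count (fun a => a = (1, false)) w) ((act flip).injective h)
    simpa [hcount s hs, hcount s' hs'] using this

theorem le_N_extremal {ℓ : ℕ} (hℓ : 3 ≤ ℓ) : 8 * (ℓ + 1) ≤ (extremal ℓ).N := by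
  classical
  let F : (Bool × Bool × Bool) × ℕ → CyclicWord 2 :=
    fun x => signedPerm x.1.1 x.1.2.1 x.1.2.2 (act (transvection (-x.2)) (extremal ℓ))
  let A := (Finset.univ : Finset (Bool × Bool × Bool)) ×ˢ Finset.range (ℓ + 1)
  have hinj : Set.InjOn F A := by
    rintro ⟨⟨i, k, j⟩, s⟩ hx ⟨⟨i', k', j'⟩, s'⟩ hx' h
    have hs : s ≤ ℓ := by simpa [A, Nat.lt_succ_iff] using hx
    have hs' : s' ≤ ℓ := by simpa [A, Nat.lt_succ_iff] using hx'
    obtain ⟨rfl, rfl, rfl, rfl⟩ := signedPerm_extremal_injective hℓ hs hs' h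
    rfl
  have hsub : ((A.image F : Finset (CyclicWord 2)) : Set (CyclicWord 2)) ⊆
      {v : CyclicWord 2 | v ∈ orbit (extremal ℓ) ∧ v.length = (extremal ℓ).length} := by
    intro v hv
    rw [Finset.mem_coe, Finset.mem_image] at hv
    obtain ⟨⟨⟨i, k, j⟩, s⟩, hx, rfl⟩ := hv
    have hs : s ≤ ℓ := by simpa [A, Nat.lt_succ_iff] using hx
    constructor
    · rw [mem_orbit_iff]
      refine ⟨cond i swap 1 * cond k (swap * flip * swap) 1 * cond j flip 1 * transvection (-s), ?_⟩
      cases i <;> cases k <;> cases j <;> simp [F, signedPerm]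
    · have hmem : signedPerm i k j ∈ Subgroup.closure {act swap, act flip} := by
        have h1 : act swap ∈ Subgroup.closure {act swap, act flip} :=
          Subgroup.subset_closure (by simp)
        have h2 : act flip ∈ Subgroup.closure {act swap, act flip} :=
          Subgroup.subset_closure (by simp)
        have h3 := mul_mem (mul_mem h1 h2) h1
        refine mul_mem (mul_mem ?_ ?_) ?_
        · cases i <;> [exact one_mem _; exact h1]
        · cases k <;> [exact one_mem _; exact h3]
        · cases j <;> [exact one_mem _; exact h2]
      simp only [F]
      rw [length_act_of_mem_closure hmem, length_eq_occ_add_occ, occ_zero_act_transvection,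
        occ_zero_extremal, occ_one_act_transvection_extremal, length_extremal]
      omega
  have h1 := Set.ncard_le_ncard hsub ((finite_length_eq _).subset fun v hv => hv.2)
  rw [Set.ncard_coe_finset, Finset.card_image_of_injOn hinj, Finset.card_product,
    Finset.card_range] at h1
  exact h1

end extremal

end CyclicWord

theorem theorem1p4 :
    -- the upper bound
    (∀ u : CyclicWord 2, u.Hyp → 9 ≤ u.length → (u.N : ℤ) ≤ 8 * (u.length : ℤ) - 40) ∧
    -- an explicit family attains the bound at every length at least nine
    (∀ ℓ : ℕ, 3 ≤ ℓ →
      (CyclicWord.extremal ℓ).Hyp ∧ (CyclicWord.extremal ℓ).length = ℓ + 6 ∧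
        ((CyclicWord.extremal ℓ).N : ℤ) = 8 * ((CyclicWord.extremal ℓ).length : ℤ) - 40) ∧
    -- the bound is attained along a sequence of cyclic words whose lengths tend to infinity
    (∃ u : ℕ → CyclicWord 2,
      (∀ l, (u l).Hyp ∧ 9 ≤ (u l).length ∧ ((u l).N : ℤ) = 8 * ((u l).length : ℤ) - 40) ∧
      Filter.Tendsto (fun l => (u l).length) Filter.atTop Filter.atTop) := by
  have hN : ∀ ℓ : ℕ, 3 ≤ ℓ →
      ((CyclicWord.extremal ℓ).N : ℤ) = 8 * ((CyclicWord.extremal ℓ).length : ℤ) - 40 := by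
    intro ℓ hℓ
    have h1 := CyclicWord.length_extremal ℓ
    have h2 := CyclicWord.N_le (CyclicWord.hyp_extremal hℓ) (by omega)
    have h3 := CyclicWord.le_N_extremal hℓ
    omega
  refine ⟨fun u hu h9 => ?_,
    fun ℓ hℓ => ⟨CyclicWord.hyp_extremal hℓ, CyclicWord.length_extremal ℓ, hN ℓ hℓ⟩,
    fun l => CyclicWord.extremal (l + 3), fun l => ⟨CyclicWord.hyp_extremal (by omega), ?_,
      hN _ (by omega)⟩, ?_⟩
  · have := CyclicWord.N_le hu h9
    omega
  · rw [CyclicWord.length_extremal]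
    omega
  · simp only [CyclicWord.length_extremal, add_assoc]
    exact Filter.tendsto_add_atTop_nat _
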